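/- For a bounded domain (nonempty connected open set) $\Omega\subset\mathbb R^2$ let $$\beta(\Omega)=\inf_{0\ne q\in L^2_\circ(\Omega)}\ \sup_{0\ne v\in H^1_0(\Omega)^2}\ \frac{\int_\Omega (\operatorname{div} v)\,q\,dx}{|v|_{1,\Omega}\,\|q\|_{0,\Omega}}$$ be its inf-sup (LBB) constant, where $L^2_\circ(\Omega)$ is the space of functions in $L^2(\Omega)$ with mean value zero, $\|\cdot\|_{0,\Omega}$ is the norm of $L^2(\Omega)$, $|v|_{1,\Omega}=\big(\sum_{j,k}\|\partial_{x_j}v_k\|_{0,\Omega}^2\big)^{1/2}$, and $H^1_0(\Omega)$ is the closure of $C_c^\infty(\Omega)$ in the $H^1$ seminorm. A *plane curved Lipschitz polygon with piecewise $C^2$ boundary* is a bounded domain $\Omega\subset\mathbb R^2$, together with a finite (possibly empty) set $C\subset\partial\Omega$ of *corners*, such that $\partial\Omega$ is a finite disjoint union of simple closed curves that are regular and of class $C^2$ away from $C$ and up to the corners from either side, and that at each corner have an opening angle distinct from $0$ and $2\pi$. (The opening angle $\pi$ is allowed.) Let $h>0$. A *polygonal $h$-approximation* of $\Omega$ is a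 bounded domain $\Omega_h$ whose boundary is obtained from $\partial\Omega$ by polygonal interpolation: on each component of $\partial\Omega$ at least three vertices are chosen, any two consecutive vertices along the component are joined by a straight side, and $\partial\Omega_h$ is the union of these sides, which form disjoint simple closed polygonal lines; moreover (i) every corner of $\Omega$ is among the vertices; (ii) the vertices belong to $\partial\Omega$; (iii) the length of each side is less than $h$; (iv) on a component of $\partial\Omega$ that contains at most one corner, each arc between consecutive vertices stays at distance less than $h$ from the side that replaces it. **Theorem.** Let $\Omega$ be a plane curved Lipschitz polygon with piecewise $C^2$ boundary. There is a constant $c(\Omega)$ such that for all $h>0$ and all polygonal $h$-approximations $\Omega_h$ of $\Omega$ $$|\beta(\Omega)-\beta(\Omega_h)|\le c(\Omega)\,h .$$ -/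

import Mathlib

open MeasureTheory Filter Topology Set
open scoped ContDiff

namespace LBB

/-! ### The inf-sup constant of the divergence -/

/-- Smooth functions with compact support contained in `Ω`. -/
def IsTestFunction {d : ℕ} (Ω : Set (EuclideanSpace ℝ (Fin d)))
    (φ : EuclideanSpace ℝ (Fin d) → ℝ) : Prop :=
  ContDiff ℝ ∞ φ ∧ HasCompactSupport φ ∧ tsupport φ ⊆ Ω

/-- The partial derivative `∂φ/∂x_j`. -/
noncomputable def partialDeriv {d : ℕ} (j : Fin d) (φ : EuclideanSpace ℝ (Fin d) → ℝ)
    (x : EuclideanSpace ℝ (Fin d)) : ℝ :=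
  fderiv ℝ φ x (EuclideanSpace.single j (1 : ℝ))

/-- `v` belongs to `H¹₀(Ω)` and has the (weak) gradient `G`, that is `G j = ∂v/∂x_j` in `L²(Ω)`:
the pair `(v, G)` is the limit, in `L²(Ω)`, of `(φ n, grad (φ n))` for test functions `φ n`. -/
structure MemH10 {d : ℕ} (Ω : Set (EuclideanSpace ℝ (Fin d)))
    (v : EuclideanSpace ℝ (Fin d) → ℝ) (G : Fin d → EuclideanSpace ℝ (Fin d) → ℝ) : Prop where
  memLp : MemLp v 2 (volume.restrict Ω)
  memLp_grad : ∀ j, MemLp (G j) 2 (volume.restrict Ω)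
  approx : ∃ φ : ℕ → EuclideanSpace ℝ (Fin d) → ℝ,
    (∀ n, IsTestFunction Ω (φ n)) ∧
    Tendsto (fun n => eLpNorm (fun x => φ n x - v x) 2 (volume.restrict Ω)) atTop (𝓝 0) ∧
    ∀ j, Tendsto (fun n => eLpNorm (fun x => partialDeriv j (φ n) x - G j x) 2
      (volume.restrict Ω)) atTop (𝓝 0)

/-- `L²₀(Ω)`: square integrable functions on `Ω` with mean value zero. -/
def MemL20 {d : ℕ} (Ω : Set (EuclideanSpace ℝ (Fin d)))
    (q : EuclideanSpace ℝ (Fin d) → ℝ) : Prop :=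
  MemLp q 2 (volume.restrict Ω) ∧ ∫ x in Ω, q x = 0

/-- The norm of `L²(Ω)`. -/
noncomputable def normL2 {d : ℕ} (Ω : Set (EuclideanSpace ℝ (Fin d)))
    (q : EuclideanSpace ℝ (Fin d) → ℝ) : ℝ :=
  Real.sqrt (∫ x in Ω, q x ^ 2)

/-- The `H¹` seminorm `(∑ₖ ∑ⱼ ‖∂ⱼ vₖ‖²)^(1/2)` of a vector field whose gradient is
`G k j = ∂ⱼ vₖ`. -/
noncomputable def seminormH1 {d : ℕ} (Ω : Set (EuclideanSpace ℝ (Fin d)))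
    (G : Fin d → Fin d → EuclideanSpace ℝ (Fin d) → ℝ) : ℝ :=
  Real.sqrt (∑ k, ∑ j, ∫ x in Ω, G k j x ^ 2)

/-- The quotients `⟨div v, q⟩ / (|v|₁ ‖q‖₀)`, where `v` runs through the nonzero elements of
`H¹₀(Ω)ᵈ`. -/
def quotients {d : ℕ} (Ω : Set (EuclideanSpace ℝ (Fin d)))
    (q : EuclideanSpace ℝ (Fin d) → ℝ) : Set ℝ :=
  {s | ∃ (v : Fin d → EuclideanSpace ℝ (Fin d) → ℝ)
      (G : Fin d → Fin d → EuclideanSpace ℝ (Fin d) → ℝ),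
      (∀ k, MemH10 Ω (v k) (G k)) ∧ 0 < seminormH1 Ω G ∧
      s = (∫ x in Ω, (∑ k, G k k x) * q x) / (seminormH1 Ω G * normL2 Ω q)}

/-- The inf-sup (LBB) constant of the divergence on `Ω`. For a nonempty open set `Ω` of dimension
`d ≥ 1` and finite measure, all the sets of reals involved are nonempty and bounded. -/
noncomputable def beta {d : ℕ} (Ω : Set (EuclideanSpace ℝ (Fin d))) : ℝ :=
  sInf {r | ∃ q : EuclideanSpace ℝ (Fin d) → ℝ,
    MemL20 Ω q ∧ 0 < normL2 Ω q ∧ r = sSup (quotients Ω q)}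

/-! ### Plane curved Lipschitz polygons -/

/-- `γ` is a (1-periodic, regular) parametrization of a simple closed plane curve that is of class
`C²`, up to the end points, on every arc without a point of `C` in its interior, and whose two
branches at a point of `C` do not leave that point in the same direction (no cusp: the opening
angle is neither `0` nor `2π`). -/
structure IsPiecewiseC2Loop (C : Set (EuclideanSpace ℝ (Fin 2)))
    (γ : ℝ → EuclideanSpace ℝ (Fin 2)) : Prop where
  periodic : Function.Periodic γ 1
  continuous : Continuous γ
  injOn : InjOn γ (Ico 0 1)
  smooth : ∀ a b : ℝ, a < b → (∀ t ∈ Ioo a b, γ t ∉ C) → ContDiffOn ℝ 2 γ (Icc a b)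
  regular : ∀ a b : ℝ, a < b → (∀ t ∈ Ioo a b, γ t ∉ C) →
    ∀ t ∈ Icc a b, derivWithin γ (Icc a b) t ≠ 0
  no_cusp : ∀ t, γ t ∈ C → ¬ SameRay ℝ (derivWithin γ (Ici t) t) (-derivWithin γ (Iic t) t)

/-- The loops `γ i` parametrize the boundary of `Ω`, piecewise of class `C²` with corners `C`. -/
structure IsBoundaryParam (Ω : Set (EuclideanSpace ℝ (Fin 2)))
    (C : Finset (EuclideanSpace ℝ (Fin 2))) {m : ℕ}
    (γ : Fin m → ℝ → EuclideanSpace ℝ (Fin 2)) : Prop where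
  loop : ∀ i, IsPiecewiseC2Loop (C : Set (EuclideanSpace ℝ (Fin 2))) (γ i)
  disjoint : ∀ i i', i ≠ i' → Disjoint (range (γ i)) (range (γ i'))
  frontier_eq : frontier Ω = ⋃ i, range (γ i)
  corners_subset : (C : Set (EuclideanSpace ℝ (Fin 2))) ⊆ frontier Ω

/-- `Ω` is a plane curved Lipschitz polygon with piecewise `C²` boundary and set of corners `C`:
a bounded domain whose boundary consists of finitely many disjoint simple closed curves that are
of class `C²` between the corners and have no cusps. Corners with opening angle `π` are allowed,
and `C` may be empty. -/
structure IsCurvedLipschitzPolygon (Ω : Set (EuclideanSpace ℝ (Fin 2)))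
    (C : Finset (EuclideanSpace ℝ (Fin 2))) : Prop where
  isOpen : IsOpen Ω
  isConnected : IsConnected Ω
  isBounded : Bornology.IsBounded Ω
  boundary : ∃ (m : ℕ) (γ : Fin m → ℝ → EuclideanSpace ℝ (Fin 2)), IsBoundaryParam Ω C γ

/-! ### Polygonal approximations -/

/-- `P` is the domain bounded by the simple closed polygonal lines with vertices `V i j`, `j : ℤ`,
the `i`-th of which has `N i ≥ 3` sides (`j` counts modulo `N i`). -/
structure IsPolygonWithVertices (P : Set (EuclideanSpace ℝ (Fin 2))) {m : ℕ} (N : Fin m → ℕ)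
    (V : Fin m → ℤ → EuclideanSpace ℝ (Fin 2)) : Prop where
  isOpen : IsOpen P
  isConnected : IsConnected P
  isBounded : Bornology.IsBounded P
  three_le : ∀ i, 3 ≤ N i
  periodic : ∀ i j, V i (j + N i) = V i j
  distinct : ∀ (i i' : Fin m) (j j' : ℤ), V i j = V i' j' → i = i' ∧ (N i : ℤ) ∣ j - j'
  simple : ∀ (i i' : Fin m) (j j' : ℤ), ¬ (i = i' ∧ (N i : ℤ) ∣ j - j') →
    Disjoint (openSegment ℝ (V i j) (V i (j + 1))) (segment ℝ (V i' j') (V i' (j' + 1)))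
  frontier_eq : frontier P = ⋃ (i : Fin m) (j : ℤ), segment ℝ (V i j) (V i (j + 1))

/-- `P` is a polygonal `h`-approximation of the curved polygon `Ω` with corners `C`: the polygon
that interpolates `∂Ω` in points `γ i (τ i j)` that include the corners, with sides shorter
than `h`. The sides join points that follow each other along `∂Ω`. The last condition concerns
only the components of `∂Ω` with at most one corner: there, each arc of `∂Ω` that is replaced by a
side stays at distance less than `h` from this side (a short side may not replace the long one of
the two arcs between its end points). -/
def IsPolygonalApproximation (Ω : Set (EuclideanSpace ℝ (Fin 2)))
    (C : Finset (EuclideanSpace ℝ (Fin 2))) (h : ℝ) (P : Set (EuclideanSpace ℝ (Fin 2))) : Prop :=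
  ∃ (m : ℕ) (γ : Fin m → ℝ → EuclideanSpace ℝ (Fin 2)) (N : Fin m → ℕ) (τ : Fin m → ℤ → ℝ),
    IsBoundaryParam Ω C γ ∧
    (∀ i, StrictMono (τ i)) ∧
    (∀ i j, τ i (j + N i) = τ i j + 1) ∧
    IsPolygonWithVertices P N (fun i j => γ i (τ i j)) ∧
    (∀ p ∈ C, ∃ i j, γ i (τ i j) = p) ∧
    (∀ i j, dist (γ i (τ i j)) (γ i (τ i (j + 1))) < h) ∧
    (∀ i, ((C : Set (EuclideanSpace ℝ (Fin 2))) ∩ range (γ i)).Subsingleton →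
      ∀ j, ∀ t ∈ Icc (τ i j) (τ i (j + 1)),
        Metric.infDist (γ i t) (segment ℝ (γ i (τ i j)) (γ i (τ i (j + 1)))) < h)

end LBB

namespace LBB

open scoped NNReal ENNReal

/-- The Euclidean plane. -/
abbrev Plane := EuclideanSpace ℝ (Fin 2)

/-- The entry `∂ⱼ fᵢ (x)` of the Jacobian matrix of `f`. -/
noncomputable def jac (f : Plane → Plane) (x : Plane) (i j : Fin 2) : ℝ :=
  fderiv ℝ f x (EuclideanSpace.single j (1 : ℝ)) i

/-- The absolute value of the Jacobian determinant. -/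
noncomputable def absDet (f : Plane → Plane) (x : Plane) : ℝ := |(fderiv ℝ f x).det|

theorem volume_image_eq_zero_of_lipschitz {L : ℝ≥0} {f : Plane → Plane} (hf : LipschitzWith L f)
    {s : Set Plane} (hs : volume s = 0) : volume (f '' s) = 0 := by
  have hd : (Module.finrank ℝ Plane : ℝ) = 2 := by simp
  have hH : (Measure.hausdorffMeasure (Module.finrank ℝ Plane : ℝ) : Measure Plane).IsAddHaarMeasure :=
    isAddHaarMeasure_hausdorffMeasure
  rw [hd] at hH
  have h1 : (Measure.hausdorffMeasure (2 : ℝ) : Measure Plane) ≪ volume :=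
    Measure.absolutelyContinuous_isAddHaarMeasure _ _
  have h2 : (volume : Measure Plane) ≪ Measure.hausdorffMeasure (2 : ℝ) :=
    Measure.absolutelyContinuous_isAddHaarMeasure _ _
  apply h2
  have h3 := hf.hausdorffMeasure_image_le (d := 2) (by norm_num) s
  rw [h1 hs, mul_zero] at h3
  exact le_antisymm h3 (zero_le)

theorem measurable_absDet (f : Plane → Plane) : Measurable (absDet f) := by
  unfold absDet
  exact (ContinuousLinearMap.continuous_det.measurable.comp (measurable_fderiv ℝ f)).norm

theorem measurable_jac (f : Plane → Plane) (i j : Fin 2) : Measurable (fun x => jac f x i j) := by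
  unfold jac
  have := (measurable_fderiv_apply_const ℝ f (EuclideanSpace.single j (1 : ℝ)))
  exact (by fun_prop : Continuous (fun v : Plane => v i)).measurable.comp this

theorem absDet_nonneg (f : Plane → Plane) (x : Plane) : 0 ≤ absDet f x := abs_nonneg _

theorem map_withDensity_homeomorph (H : Plane ≃ₜ Plane) {L : ℝ≥0} (hL : LipschitzWith L H)
    {U : Set Plane} (hU : MeasurableSet U) :
    Measure.map H ((volume.restrict (H ⁻¹' U)).withDensity
      fun x => ENNReal.ofReal (absDet H x)) = volume.restrict U := by
  have hae : ∀ᵐ x, DifferentiableAt ℝ H x := hL.ae_differentiableAt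
  set D : Set Plane := {x | DifferentiableAt ℝ H x} with hD
  have hDm : MeasurableSet D := measurableSet_of_differentiableAt ℝ H
  have hDc : volume Dᶜ = 0 := hae
  have hUm : MeasurableSet (H ⁻¹' U) := H.continuous.measurable hU
  have key := map_withDensity_abs_det_fderiv_eq_addHaar (s := H ⁻¹' U ∩ D) volume
    (f := H) (f' := fderiv ℝ H) (hUm.inter hDm).nullMeasurableSet
    (fun x hx => hx.2.hasFDerivAt.hasFDerivWithinAt) H.injective.injOn
  have e1 : (volume.restrict (H ⁻¹' U ∩ D) : Measure Plane) = volume.restrict (H ⁻¹' U) := by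
    apply Measure.restrict_congr_set
    rw [ae_eq_set]
    refine ⟨measure_mono_null (t := ∅) (fun x hx => (hx.2 hx.1.1).elim) measure_empty,
      measure_mono_null (t := Dᶜ) ?_ hDc⟩
    rintro x ⟨h1, h2⟩ h3
    exact h2 ⟨h1, h3⟩
  have e2 : (volume.restrict (H '' (H ⁻¹' U ∩ D)) : Measure Plane) = volume.restrict U := by
    apply Measure.restrict_congr_set
    rw [ae_eq_set]
    constructor
    · rw [sdiff_eq_empty.2, measure_empty]
      rintro _ ⟨x, hx, rfl⟩
      exact hx.1
    · refine measure_mono_null (t := H '' Dᶜ) ?_ (volume_image_eq_zero_of_lipschitz hL hDc)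
      rintro y ⟨h1, h2⟩
      refine ⟨H.symm y, fun h3 => h2 ⟨H.symm y, ⟨by simpa using h1, h3⟩, by simp⟩, by simp⟩
  rw [e1, e2] at key
  exact key

theorem setIntegral_homeomorph (H : Plane ≃ₜ Plane) {L : ℝ≥0} (hL : LipschitzWith L H)
    {U : Set Plane} (hU : MeasurableSet U) (g : Plane → ℝ) :
    ∫ x in U, g x = ∫ x in H ⁻¹' U, absDet H x * g (H x) := by
  rw [← map_withDensity_homeomorph H hL hU, H.measurableEmbedding.integral_map]
  have : (fun x => ENNReal.ofReal (absDet H x)) =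
      fun x => ((Real.toNNReal (absDet H x) : ℝ≥0) : ℝ≥0∞) := rfl
  rw [this, integral_withDensity_eq_integral_smul (measurable_absDet H).real_toNNReal]
  refine integral_congr_ae (Eventually.of_forall fun x => ?_)
  simp [NNReal.smul_def, Real.coe_toNNReal _ (absDet_nonneg H x)]

/-! ### Maps close to the identity -/

/-- `f - id` is Lipschitz with constant `ε`. -/
def NearId (ε : ℝ≥0) (f : Plane → Plane) : Prop := LipschitzWith ε fun x => f x - x

theorem NearId.lipschitz {ε : ℝ≥0} {f : Plane → Plane} (h : NearId ε f) :
    LipschitzWith (ε + 1) f := by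
  have := LipschitzWith.add h LipschitzWith.id
  simpa using this

theorem NearId.abs_jac_sub_le {ε : ℝ≥0} {f : Plane → Plane} (h : NearId ε f) {x : Plane}
    (hx : DifferentiableAt ℝ f x) (i j : Fin 2) :
    |jac f x i j - if i = j then 1 else 0| ≤ ε := by
  have h1 : fderiv ℝ (fun x => f x - x) x = fderiv ℝ f x - ContinuousLinearMap.id ℝ Plane := by
    have := (hx.hasFDerivAt.sub (hasFDerivAt_id x)).fderiv
    exact this
  have h2 : ‖fderiv ℝ (fun x => f x - x) x‖ ≤ ε := norm_fderiv_le_of_lipschitz ℝ h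
  have h3 : jac f x i j - (if i = j then 1 else 0) =
      (fderiv ℝ (fun x => f x - x) x (EuclideanSpace.single j (1 : ℝ))) i := by
    rw [h1]
    simp [jac]
  rw [h3]
  calc _ ≤ ‖fderiv ℝ (fun x => f x - x) x (EuclideanSpace.single j (1 : ℝ))‖ := by
        simpa using PiLp.norm_apply_le (fderiv ℝ (fun x => f x - x) x
          (EuclideanSpace.single j (1 : ℝ))) i
    _ ≤ ‖fderiv ℝ (fun x => f x - x) x‖ * ‖EuclideanSpace.single j (1 : ℝ)‖ :=
        ContinuousLinearMap.le_opNorm _ _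
    _ ≤ ε := by simpa using h2

theorem absDet_eq (f : Plane → Plane) (x : Plane) :
    absDet f x = |jac f x 0 0 * jac f x 1 1 - jac f x 0 1 * jac f x 1 0| := by
  unfold absDet
  congr 1
  rw [ContinuousLinearMap.det, ← LinearMap.det_toMatrix (EuclideanSpace.basisFun (Fin 2) ℝ).toBasis,
    Matrix.det_fin_two]
  simp [LinearMap.toMatrix_apply, jac]

theorem NearId.absDet_bounds {ε : ℝ≥0} {f : Plane → Plane} (h : NearId ε f) (hε : ε ≤ 1 / 8)
    {x : Plane} (hx : DifferentiableAt ℝ f x) :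
    1 - 3 * (ε : ℝ) ≤ absDet f x ∧ absDet f x ≤ 1 + 3 * ε := by
  have h0 := h.abs_jac_sub_le hx 0 0
  have h1 := h.abs_jac_sub_le hx 0 1
  have h2 := h.abs_jac_sub_le hx 1 0
  have h3 := h.abs_jac_sub_le hx 1 1
  simp only [Fin.isValue, if_true, zero_ne_one, one_ne_zero, if_false, sub_zero] at h0 h1 h2 h3
  have hε' : (ε : ℝ) ≤ 1 / 8 := by exact_mod_cast hε
  have hε0 : (0 : ℝ) ≤ ε := ε.2
  rw [absDet_eq]
  set a := jac f x 0 0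
  set b := jac f x 0 1
  set c := jac f x 1 0
  set d := jac f x 1 1
  have hbc : |b * c| ≤ ε * ε := by rw [abs_mul]; gcongr
  have had : |(a - 1) * (d - 1)| ≤ ε * ε := by rw [abs_mul]; gcongr
  rw [abs_le] at h0 h3 hbc had
  have hee : (ε : ℝ) * ε ≤ ε / 8 := by nlinarith
  have hpos : 1 - 3 * (ε : ℝ) ≤ a * d - b * c := by nlinarith
  have hle : a * d - b * c ≤ 1 + 3 * (ε : ℝ) := by nlinarith
  rw [abs_of_nonneg (by linarith)]
  exact ⟨hpos, hle⟩

theorem NearId.ae_differentiableAt {ε : ℝ≥0} {f : Plane → Plane} (h : NearId ε f) :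
    ∀ᵐ x, DifferentiableAt ℝ f x :=
  h.lipschitz.ae_differentiableAt

theorem tendsto_eLpNorm_zero_of_dominated {α : Type*} [MeasurableSpace α] {μ : Measure α}
    [IsFiniteMeasure μ] {f : ℕ → α → ℝ} {B : ℝ} (hf : ∀ n, AEStronglyMeasurable (f n) μ)
    (hB : ∀ n, ∀ᵐ x ∂μ, |f n x| ≤ B) (h : ∀ᵐ x ∂μ, Tendsto (fun n => f n x) atTop (𝓝 0)) :
    Tendsto (fun n => eLpNorm (f n) 2 μ) atTop (𝓝 0) := by
  have key : Tendsto (fun n => ∫⁻ x, ‖f n x‖ₑ ^ (2 : ℝ) ∂μ) atTop (𝓝 (∫⁻ _, 0 ∂μ)) := by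
    refine tendsto_lintegral_of_dominated_convergence' (fun _ => ENNReal.ofReal B ^ (2 : ℝ))
      (fun n => (hf n).enorm.pow_const _) (fun n => ?_) ?_ ?_
    · filter_upwards [hB n] with x hx
      gcongr
      rw [← ofReal_norm]
      exact ENNReal.ofReal_le_ofReal hx
    · rw [lintegral_const]
      exact ENNReal.mul_ne_top (ENNReal.rpow_ne_top_of_nonneg (by norm_num) ENNReal.ofReal_ne_top)
        (measure_ne_top _ _)
    · filter_upwards [h] with x hx
      have h1 : Tendsto (fun n => ‖f n x‖ₑ) atTop (𝓝 0) := by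
        simpa [Function.comp_def] using (continuous_enorm.tendsto _).comp hx
      have h2 := (ENNReal.continuous_rpow_const (y := (2 : ℝ))).tendsto 0 |>.comp h1
      simpa [Function.comp_def] using h2
  rw [lintegral_zero] at key
  have h2 := ((ENNReal.continuous_rpow_const (y := (1 / 2 : ℝ))).tendsto 0).comp key
  refine (h2.congr fun n => ?_).trans_eq ?_
  · rw [eLpNorm_eq_lintegral_rpow_enorm_toReal (by norm_num) (by norm_num)]
    simp
  · simp

theorem hasFDerivAt_convolution_lipschitz {ρ u : Plane → ℝ} {L : ℝ≥0} (hρ : Continuous ρ)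
    (hρc : HasCompactSupport ρ) (hu : LipschitzWith L u) (x₀ : Plane) :
    Integrable (fun t => ρ t • fderiv ℝ u (x₀ - t)) ∧
    HasFDerivAt (convolution ρ u (ContinuousLinearMap.lsmul ℝ ℝ) volume)
      (∫ t, ρ t • fderiv ℝ u (x₀ - t)) x₀ := by
  have hint : Integrable ρ := hρ.integrable_of_hasCompactSupport hρc
  have hcont : ∀ x, Continuous fun t => ρ t • u (x - t) := fun x =>
    hρ.smul (hu.continuous.comp (continuous_const.sub continuous_id))
  refine hasFDerivAt_integral_of_dominated_loc_of_lip (F := fun x t => ρ t • u (x - t))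
    (bound := fun t => L * ‖ρ t‖) (s := univ) univ_mem
    (Eventually.of_forall fun x => (hcont x).aestronglyMeasurable)
    ((hcont x₀).integrable_of_hasCompactSupport hρc.smul_right) ?_ ?_ (hint.norm.const_mul _) ?_
  · have h1 : Measurable fun t => fderiv ℝ u (x₀ - t) :=
      (measurable_fderiv ℝ u).comp (measurable_const.sub measurable_id)
    exact hρ.aestronglyMeasurable.smul h1.aestronglyMeasurable
  · refine Eventually.of_forall fun t => LipschitzOnWith.of_dist_le_mul fun x _ y _ => ?_
    have h2 := hu.dist_le_mul (x - t) (y - t)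
    rw [dist_sub_right] at h2
    rw [dist_smul₀, Real.coe_nnabs, abs_of_nonneg (by positivity)]
    calc ‖ρ t‖ * dist (u (x - t)) (u (y - t)) ≤ ‖ρ t‖ * (L * dist x y) := by gcongr
      _ = _ := by ring
  · have h3 := (quasiMeasurePreserving_sub_left (volume : Measure Plane) x₀).ae
      (hu.ae_differentiableAt (μ := volume))
    filter_upwards [h3] with t ht
    have h4 : HasFDerivAt (fun x => u (x - t)) (fderiv ℝ u (x₀ - t)) x₀ := by
      have := ht.hasFDerivAt.comp x₀ ((hasFDerivAt_id x₀).sub_const t)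
      rw [ContinuousLinearMap.comp_id] at this
      exact this
    exact h4.const_smul (ρ t)

theorem partialDeriv_convolution_lipschitz {ρ u : Plane → ℝ} {L : ℝ≥0} (hρ : Continuous ρ)
    (hρc : HasCompactSupport ρ) (hu : LipschitzWith L u) (j : Fin 2) :
    partialDeriv j (convolution ρ u (ContinuousLinearMap.lsmul ℝ ℝ) volume) =
      convolution ρ (partialDeriv j u) (ContinuousLinearMap.lsmul ℝ ℝ) volume := by
  ext x
  obtain ⟨h1, h2⟩ := hasFDerivAt_convolution_lipschitz hρ hρc hu x
  unfold partialDeriv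
  rw [h2.fderiv, ContinuousLinearMap.integral_apply h1]
  rfl

theorem measurable_partialDeriv (j : Fin 2) (u : Plane → ℝ) : Measurable (partialDeriv j u) :=
  measurable_fderiv_apply_const ℝ u _

theorem abs_partialDeriv_le {u : Plane → ℝ} {L : ℝ≥0} (hu : LipschitzWith L u) (j : Fin 2)
    (x : Plane) : |partialDeriv j u x| ≤ L := by
  unfold partialDeriv
  calc |fderiv ℝ u x (EuclideanSpace.single j (1 : ℝ))|
      ≤ ‖fderiv ℝ u x‖ * ‖(EuclideanSpace.single j (1 : ℝ) : Plane)‖ :=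
        (fderiv ℝ u x).le_opNorm _
    _ ≤ L := by simpa using norm_fderiv_le_of_lipschitz ℝ hu (x₀ := x)

theorem abs_normed_convolution_le (φ : ContDiffBump (0 : Plane)) {g : Plane → ℝ} {B : ℝ}
    (hB : ∀ x, |g x| ≤ B) (x : Plane) :
    |convolution (φ.normed volume) g (ContinuousLinearMap.lsmul ℝ ℝ) volume x| ≤ B := by
  have hi : Integrable (φ.normed (volume : Measure Plane)) := φ.integrable_normed
  calc |∫ t, φ.normed volume t * g (x - t)| ≤ ∫ t, φ.normed volume t * B := by
        rw [← Real.norm_eq_abs]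
        refine norm_integral_le_of_norm_le (hi.mul_const B) (Eventually.of_forall fun t => ?_)
        rw [norm_mul, Real.norm_of_nonneg (φ.nonneg_normed t)]
        exact mul_le_mul_of_nonneg_left (hB _) (φ.nonneg_normed t)
    _ = B := by rw [integral_mul_const, φ.integral_normed, one_mul]

theorem exists_testFunction_near {Ω : Set Plane} (hΩ : IsOpen Ω) (hfin : volume Ω ≠ ⊤)
    {u : Plane → ℝ} {L : ℝ≥0} (hu : LipschitzWith L u) (hc : HasCompactSupport u)
    (hs : tsupport u ⊆ Ω) {δ : ℝ≥0∞} (hδ : 0 < δ) :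
    ∃ φ, IsTestFunction Ω φ ∧ eLpNorm (fun x => φ x - u x) 2 (volume.restrict Ω) ≤ δ ∧
      ∀ j, eLpNorm (fun x => partialDeriv j φ x - partialDeriv j u x) 2
        (volume.restrict Ω) ≤ δ := by
  have : IsFiniteMeasure (volume.restrict Ω : Measure Plane) :=
    ⟨by simpa using lt_top_iff_ne_top.2 hfin⟩
  let b : ℕ → ContDiffBump (0 : Plane) := fun n =>
    { rIn := 1 / ((n : ℝ) + 1) / 2, rOut := 1 / ((n : ℝ) + 1), rIn_pos := by positivity,
      rIn_lt_rOut := by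
        have : (0 : ℝ) < 1 / ((n : ℝ) + 1) := by positivity
        linarith }
  have hb : Tendsto (fun n => (b n).rOut) atTop (𝓝 0) := tendsto_one_div_add_atTop_nhds_zero_nat
  let f : ℕ → Plane → ℝ := fun n =>
    convolution ((b n).normed volume) u (ContinuousLinearMap.lsmul ℝ ℝ) volume
  have hcont : ∀ n, ContDiff ℝ ∞ (f n) := fun n =>
    (b n).hasCompactSupport_normed.contDiff_convolution_left _ (b n).contDiff_normed
      hu.continuous.locallyIntegrable
  have hsupp : ∀ᶠ n in atTop, IsTestFunction Ω (f n) := by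
    obtain ⟨r, hr, hrΩ⟩ := hc.isCompact.exists_cthickening_subset_open hΩ hs
    filter_upwards [hb.eventually (gt_mem_nhds hr)] with n hn
    have hsub : Function.support (f n) ⊆ Metric.cthickening r (tsupport u) := by
      refine (support_convolution_subset _).trans ?_
      rw [(b n).support_normed_eq]
      rintro _ ⟨x, hx, y, hy, rfl⟩
      refine Metric.mem_cthickening_of_dist_le _ y _ _ (subset_tsupport _ hy) ?_
      rw [mem_ball_zero_iff] at hx
      simpa using (hx.trans hn).le
    have hts : tsupport (f n) ⊆ Metric.cthickening r (tsupport u) :=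
      closure_minimal hsub Metric.isClosed_cthickening
    exact ⟨hcont n, hc.isCompact.cthickening.of_isClosed_subset (isClosed_tsupport _) hts,
      hts.trans hrΩ⟩
  have h0 : Tendsto (fun n => eLpNorm (fun x => f n x - u x) 2 (volume.restrict Ω)) atTop
      (𝓝 0) := by
    have hle : ∀ n x, |f n x - u x| ≤ L * (b n).rOut := by
      intro n x
      rw [← Real.dist_eq]
      refine (b n).dist_normed_convolution_le hu.continuous.aestronglyMeasurable fun y hy => ?_
      exact (hu.dist_le_mul y x).trans (by gcongr; exact (Metric.mem_ball.1 hy).le)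
    refine tendsto_eLpNorm_zero_of_dominated (B := L) (fun n => ?_) (fun n => ?_) ?_
    · exact ((hcont n).continuous.sub hu.continuous).aestronglyMeasurable
    · refine Eventually.of_forall fun x => (hle n x).trans ?_
      refine mul_le_of_le_one_right L.2 ?_
      change 1 / ((n : ℝ) + 1) ≤ 1
      rw [div_le_one (by positivity)]
      linarith [(n.cast_nonneg : (0 : ℝ) ≤ n)]
    · refine Eventually.of_forall fun x => ?_
      refine squeeze_zero_norm (hle · x) ?_
      simpa using hb.const_mul (L : ℝ)
  have h1 : ∀ j, Tendsto (fun n => eLpNorm (fun x => partialDeriv j (f n) x - partialDeriv j u x) 2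
      (volume.restrict Ω)) atTop (𝓝 0) := by
    intro j
    have hfj : ∀ n, partialDeriv j (f n) = convolution ((b n).normed volume) (partialDeriv j u)
        (ContinuousLinearMap.lsmul ℝ ℝ) volume := fun n =>
      partialDeriv_convolution_lipschitz (b n).continuous_normed (b n).hasCompactSupport_normed hu j
    refine tendsto_eLpNorm_zero_of_dominated (B := L + L) (fun n => ?_) (fun n => ?_) ?_
    · exact ((measurable_partialDeriv j _).sub (measurable_partialDeriv j _)).aestronglyMeasurable
    · refine Eventually.of_forall fun x => (abs_sub _ _).trans ?_
      rw [hfj]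
      exact add_le_add (abs_normed_convolution_le _ (abs_partialDeriv_le hu j) x)
        (abs_partialDeriv_le hu j x)
    · have hloc : LocallyIntegrable (partialDeriv j u) (volume : Measure Plane) := by
        refine (locallyIntegrable_const (L : ℝ)).mono
          (measurable_partialDeriv j u).aestronglyMeasurable (Eventually.of_forall fun x => ?_)
        simpa using abs_partialDeriv_le hu j x
      have := ContDiffBump.ae_convolution_tendsto_right_of_locallyIntegrable (K := 2) hb
        (Eventually.of_forall fun n => by
          change 1 / ((n : ℝ) + 1) ≤ 2 * (1 / ((n : ℝ) + 1) / 2)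
          linarith) hloc
      filter_upwards [ae_restrict_of_ae this] with x hx
      simp_rw [hfj]
      simpa using hx.sub_const (partialDeriv j u x)
  have hev : ∀ᶠ n in atTop, IsTestFunction Ω (f n) ∧
      eLpNorm (fun x => f n x - u x) 2 (volume.restrict Ω) ≤ δ ∧
      ∀ j, eLpNorm (fun x => partialDeriv j (f n) x - partialDeriv j u x) 2
        (volume.restrict Ω) ≤ δ := by
    refine hsupp.and (((h0.eventually (gt_mem_nhds hδ)).mono fun n hn => hn.le).and ?_)
    rw [eventually_all]
    exact fun j => ((h1 j).eventually (gt_mem_nhds hδ)).mono fun n hn => hn.le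
  obtain ⟨n, hn⟩ := hev.exists
  exact ⟨f n, hn⟩

/-- `H` maps `V` onto `U`, and both `H` and its inverse are close to the identity. -/
structure NearIdEquiv (ε : ℝ≥0) (H : Plane ≃ₜ Plane) (V U : Set Plane) : Prop where
  le : ε ≤ 1 / 16
  nearId : NearId ε H
  nearId_symm : NearId ε H.symm
  isOpen : IsOpen U
  measure_ne_top : volume U ≠ ⊤
  eq_preimage : V = H ⁻¹' U

namespace NearIdEquiv

variable {ε : ℝ≥0} {H : Plane ≃ₜ Plane} {V U : Set Plane}

theorem isOpen' (h : NearIdEquiv ε H V U) : IsOpen V := by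
  rw [h.eq_preimage]
  exact h.isOpen.preimage H.continuous

theorem eps_le (h : NearIdEquiv ε H V U) : (ε : ℝ) ≤ 1 / 16 := by exact_mod_cast h.le

theorem absDet_bounds (h : NearIdEquiv ε H V U) :
    ∀ᵐ x, 1 - 3 * (ε : ℝ) ≤ absDet H x ∧ absDet H x ≤ 1 + 3 * ε := by
  filter_upwards [h.nearId.ae_differentiableAt] with x hx
  refine h.nearId.absDet_bounds (h.le.trans ?_) hx
  rw [← NNReal.coe_le_coe]; norm_num

theorem absDet_le_two (h : NearIdEquiv ε H V U) : ∀ᵐ x, absDet H x ≤ 2 := by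
  filter_upwards [h.absDet_bounds] with x hx
  linarith [h.eps_le, hx.2]

theorem map_eq (h : NearIdEquiv ε H V U) :
    Measure.map H ((volume.restrict V).withDensity fun x => ENNReal.ofReal (absDet H x)) =
      volume.restrict U := by
  rw [h.eq_preimage]
  exact map_withDensity_homeomorph H h.nearId.lipschitz h.isOpen.measurableSet

theorem integral_eq (h : NearIdEquiv ε H V U) (g : Plane → ℝ) :
    ∫ x in U, g x = ∫ x in V, absDet H x * g (H x) := by
  rw [h.eq_preimage]
  exact setIntegral_homeomorph H h.nearId.lipschitz h.isOpen.measurableSet g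

theorem eLpNorm_comp_symm_le (h : NearIdEquiv ε H V U) (f : Plane → ℝ) :
    eLpNorm (fun x => f (H.symm x)) 2 (volume.restrict U) ≤
      2 * eLpNorm f 2 (volume.restrict V) := by
  rw [← h.map_eq, H.measurableEmbedding.eLpNorm_map_measure]
  have h1 : (fun x => f (H.symm x)) ∘ H = f := by ext; simp
  rw [h1]
  have h2 : ((volume.restrict V).withDensity fun x => ENNReal.ofReal (absDet H x)) ≤
      (2 : ℝ≥0∞) • (volume.restrict V) := by
    rw [← withDensity_const]
    refine withDensity_mono (ae_restrict_of_ae ?_)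
    filter_upwards [h.absDet_le_two] with x hx
    simpa using ENNReal.ofReal_le_ofReal hx
  refine (eLpNorm_mono_measure f h2).trans ?_
  rw [eLpNorm_smul_measure_of_ne_top (by norm_num), smul_eq_mul]
  gcongr
  refine (ENNReal.rpow_le_rpow_of_exponent_le (by norm_num)
    (?_ : (1 / (2 : ℝ≥0∞)).toReal ≤ 1)).trans_eq (ENNReal.rpow_one _)
  norm_num

theorem aestronglyMeasurable_comp_symm (h : NearIdEquiv ε H V U) {f : Plane → ℝ}
    (hf : AEStronglyMeasurable f (volume.restrict V)) :
    AEStronglyMeasurable (fun x => f (H.symm x)) (volume.restrict U) := by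
  rw [← h.map_eq, H.measurableEmbedding.aestronglyMeasurable_map_iff]
  have h1 : (fun x => f (H.symm x)) ∘ H = f := by ext; simp
  rw [h1]
  exact hf.mono_ac (withDensity_absolutelyContinuous _ _)

theorem memLp_comp_symm (h : NearIdEquiv ε H V U) {f : Plane → ℝ}
    (hf : MemLp f 2 (volume.restrict V)) :
    MemLp (fun x => f (H.symm x)) 2 (volume.restrict U) :=
  ⟨h.aestronglyMeasurable_comp_symm hf.1,
    (h.eLpNorm_comp_symm_le f).trans_lt (ENNReal.mul_lt_top (by norm_num) hf.2)⟩

theorem symm (h : NearIdEquiv ε H V U) : NearIdEquiv ε H.symm U V where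
  le := h.le
  nearId := h.nearId_symm
  nearId_symm := h.nearId
  isOpen := h.isOpen'
  measure_ne_top := by
    have h2 : (volume.restrict U : Measure Plane) univ ≠ ⊤ := by simpa using h.measure_ne_top
    have h3 : Measure.map H ((volume.restrict V).withDensity
      fun x => ENNReal.ofReal (absDet H x)) univ ≠ ⊤ := by rwa [h.map_eq]
    rw [Measure.map_apply H.continuous.measurable MeasurableSet.univ, preimage_univ,
      withDensity_apply _ MeasurableSet.univ, Measure.restrict_univ] at h3
    have h4 : ∫⁻ _ in V, ENNReal.ofReal (1 / 2) ≤ ∫⁻ x in V, ENNReal.ofReal (absDet H x) := by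
      refine lintegral_mono_ae (ae_restrict_of_ae ?_)
      filter_upwards [h.absDet_bounds] with x hx
      exact ENNReal.ofReal_le_ofReal (by linarith [h.eps_le, hx.1])
    rw [setLIntegral_const] at h4
    intro h5
    rw [h5, ENNReal.mul_top (by simp)] at h4
    exact h3 (top_le_iff.1 h4)
  eq_preimage := by rw [h.eq_preimage, ← preimage_comp]; simp

theorem abs_jac_symm_sub_le (h : NearIdEquiv ε H V U) :
    ∀ᵐ x, ∀ i j, |jac H.symm x i j - if i = j then 1 else 0| ≤ ε := by
  filter_upwards [h.nearId_symm.ae_differentiableAt] with x hx i j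
  exact h.nearId_symm.abs_jac_sub_le hx i j

theorem abs_jac_symm_le (h : NearIdEquiv ε H V U) : ∀ᵐ x, ∀ i j, |jac H.symm x i j| ≤ 2 := by
  filter_upwards [h.abs_jac_symm_sub_le] with x hx i j
  have h1 := abs_le.1 (hx i j)
  have h2 := h.eps_le
  rw [abs_le]
  split_ifs at h1 <;> constructor <;> linarith

theorem eLpNorm_comp_symm_mul_jac_le (h : NearIdEquiv ε H V U) (f : Plane → ℝ) (i j : Fin 2) :
    eLpNorm (fun x => f (H.symm x) * jac H.symm x i j) 2 (volume.restrict U) ≤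
      4 * eLpNorm f 2 (volume.restrict V) := by
  have h1 : eLpNorm (fun x => f (H.symm x) * jac H.symm x i j) 2 (volume.restrict U) ≤
      ENNReal.ofReal 2 * eLpNorm (fun x => f (H.symm x)) 2 (volume.restrict U) := by
    refine eLpNorm_le_mul_eLpNorm_of_ae_le_mul (ae_restrict_of_ae ?_) 2
    filter_upwards [h.abs_jac_symm_le] with x hx
    rw [norm_mul, mul_comm]
    exact mul_le_mul_of_nonneg_right (hx i j) (norm_nonneg _)
  refine h1.trans ?_
  calc _ ≤ ENNReal.ofReal 2 * (2 * eLpNorm f 2 (volume.restrict V)) := by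
        gcongr
        exact h.eLpNorm_comp_symm_le f
    _ = _ := by
        rw [← mul_assoc]
        congr 1
        rw [ENNReal.ofReal_ofNat]
        norm_num

theorem memLp_comp_symm_mul_jac (h : NearIdEquiv ε H V U) {f : Plane → ℝ}
    (hf : MemLp f 2 (volume.restrict V)) (i j : Fin 2) :
    MemLp (fun x => f (H.symm x) * jac H.symm x i j) 2 (volume.restrict U) :=
  ⟨(h.aestronglyMeasurable_comp_symm hf.1).mul (measurable_jac _ i j).aestronglyMeasurable,
    (h.eLpNorm_comp_symm_mul_jac_le f i j).trans_lt (ENNReal.mul_lt_top (by norm_num) hf.2)⟩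

end NearIdEquiv

theorem fderiv_single_eq_sum_jac (f : Plane → Plane) (x : Plane) (j : Fin 2) :
    fderiv ℝ f x (EuclideanSpace.single j (1 : ℝ)) =
      ∑ i, jac f x i j • (EuclideanSpace.single i (1 : ℝ) : Plane) := by
  ext k
  fin_cases k <;> simp [jac, Fin.sum_univ_two]

theorem partialDeriv_comp {φ : Plane → ℝ} {K : Plane → Plane} {x : Plane}
    (hφ : DifferentiableAt ℝ φ (K x)) (hK : DifferentiableAt ℝ K x) (j : Fin 2) :
    partialDeriv j (fun x => φ (K x)) x = ∑ i, partialDeriv i φ (K x) * jac K x i j := by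
  unfold partialDeriv
  have h1 : fderiv ℝ (fun x => φ (K x)) x = (fderiv ℝ φ (K x)).comp (fderiv ℝ K x) :=
    fderiv_comp x hφ hK
  rw [h1, ContinuousLinearMap.comp_apply, fderiv_single_eq_sum_jac, map_sum]
  refine Finset.sum_congr rfl fun i _ => ?_
  rw [map_smul, smul_eq_mul, mul_comm]

theorem memH10_of_forall_exists {Ω : Set Plane} {v : Plane → ℝ} {G : Fin 2 → Plane → ℝ}
    (hv : MemLp v 2 (volume.restrict Ω)) (hG : ∀ j, MemLp (G j) 2 (volume.restrict Ω))
    (h : ∀ δ : ℝ≥0∞, 0 < δ → ∃ φ, IsTestFunction Ω φ ∧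
      eLpNorm (fun x => φ x - v x) 2 (volume.restrict Ω) ≤ δ ∧
      ∀ j, eLpNorm (fun x => partialDeriv j φ x - G j x) 2 (volume.restrict Ω) ≤ δ) :
    MemH10 Ω v G := by
  choose φ h1 h2 h3 using fun n : ℕ => h (n : ℝ≥0∞)⁻¹ (ENNReal.inv_pos.2 (ENNReal.natCast_ne_top n))
  refine ⟨hv, hG, φ, h1, ?_, fun j => ?_⟩
  · exact tendsto_of_tendsto_of_tendsto_of_le_of_le tendsto_const_nhds
      ENNReal.tendsto_inv_nat_nhds_zero (fun _ => zero_le) h2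
  · exact tendsto_of_tendsto_of_tendsto_of_le_of_le tendsto_const_nhds
      ENNReal.tendsto_inv_nat_nhds_zero (fun _ => zero_le) (fun n => h3 n j)

theorem NearIdEquiv.memH10_comp_symm {ε : ℝ≥0} {H : Plane ≃ₜ Plane} {V U : Set Plane}
    (h : NearIdEquiv ε H V U) {v : Plane → ℝ} {G : Fin 2 → Plane → ℝ} (hv : MemH10 V v G) :
    MemH10 U (fun x => v (H.symm x))
      (fun j x => ∑ i, G i (H.symm x) * jac H.symm x i j) := by
  have hGm : ∀ j, MemLp (fun x => ∑ i, G i (H.symm x) * jac H.symm x i j) 2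
      (volume.restrict U) := fun j =>
    memLp_finsetSum _ fun i _ => h.memLp_comp_symm_mul_jac (hv.memLp_grad i) i j
  refine memH10_of_forall_exists (h.memLp_comp_symm hv.memLp) hGm fun δ hδ => ?_
  obtain ⟨φ, hφ, hφv, hφG⟩ := hv.approx
  have hδ' : 0 < δ / 9 := ENNReal.div_pos hδ.ne' (by norm_num)
  obtain ⟨n, hn1, hn2⟩ : ∃ n, eLpNorm (fun x => φ n x - v x) 2 (volume.restrict V) ≤ δ / 9 ∧
      ∀ j, eLpNorm (fun x => partialDeriv j (φ n) x - G j x) 2 (volume.restrict V) ≤ δ / 9 := by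
    have := ((hφv.eventually (gt_mem_nhds hδ')).mono fun n hn => hn.le).and
      (eventually_all.2 fun j => ((hφG j).eventually (gt_mem_nhds hδ')).mono fun n hn => hn.le)
    exact this.exists
  obtain ⟨hsm, hcs, hts⟩ := hφ n
  obtain ⟨L, hL⟩ := ContDiff.lipschitzWith_of_hasCompactSupport hcs hsm (by simp)
  have hu := hL.comp h.nearId_symm.lipschitz
  obtain ⟨ψ, hψ, hψ1, hψ2⟩ := exists_testFunction_near h.isOpen h.measure_ne_top hu
    (hcs.comp_homeomorph H.symm) (by
      rw [tsupport_comp_eq_preimage, h.symm.eq_preimage]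
      exact preimage_mono hts) hδ'
  have hum : AEStronglyMeasurable (fun x => φ n (H.symm x)) (volume.restrict U) :=
    hu.continuous.aestronglyMeasurable
  refine ⟨ψ, hψ, ?_, fun j => ?_⟩
  · have e : (fun x => ψ x - v (H.symm x)) =
        (fun x => ψ x - φ n (H.symm x)) + fun x => φ n (H.symm x) - v (H.symm x) := by
      ext x; simp
    rw [e]
    refine (eLpNorm_add_le (hψ.1.continuous.aestronglyMeasurable.sub hum)
      (hum.sub (h.memLp_comp_symm hv.memLp).1) (by norm_num)).trans ?_
    calc _ ≤ δ / 9 + 2 * (δ / 9) := by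
          refine add_le_add hψ1 ((h.eLpNorm_comp_symm_le fun x => φ n x - v x).trans ?_)
          gcongr
      _ = 3 * (δ / 9) := by ring
      _ ≤ 9 * (δ / 9) := by gcongr; norm_num
      _ = δ := ENNReal.mul_div_cancel (by norm_num) (by norm_num)
  · have e : (fun x => partialDeriv j ψ x - ∑ i, G i (H.symm x) * jac H.symm x i j)
        =ᵐ[volume.restrict U] ((fun x => partialDeriv j ψ x - partialDeriv j (φ n ∘ H.symm) x) +
          ((fun x => (partialDeriv 0 (φ n) (H.symm x) - G 0 (H.symm x)) * jac H.symm x 0 j) +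
          fun x => (partialDeriv 1 (φ n) (H.symm x) - G 1 (H.symm x)) * jac H.symm x 1 j)) := by
      filter_upwards [ae_restrict_of_ae h.nearId_symm.ae_differentiableAt] with x hx
      have := partialDeriv_comp (hsm.differentiable (by simp) (H.symm x)) hx j
      simp only [Pi.add_apply]
      rw [show φ n ∘ H.symm = fun x => φ n (H.symm x) from rfl, this]
      simp only [Fin.sum_univ_two]
      ring
    rw [eLpNorm_congr_ae e]
    have hpd : ∀ i, AEStronglyMeasurable (fun x => (partialDeriv i (φ n) (H.symm x) -
        G i (H.symm x)) * jac H.symm x i j) (volume.restrict U) := fun i =>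
      (h.aestronglyMeasurable_comp_symm ((measurable_partialDeriv i _).aestronglyMeasurable.sub
        (hv.memLp_grad i).1)).mul (measurable_jac _ i j).aestronglyMeasurable
    have hle : ∀ i, eLpNorm (fun x => (partialDeriv i (φ n) (H.symm x) -
        G i (H.symm x)) * jac H.symm x i j) 2 (volume.restrict U) ≤ 4 * (δ / 9) := fun i =>
      (h.eLpNorm_comp_symm_mul_jac_le (fun x => partialDeriv i (φ n) x - G i x) i j).trans
        (by gcongr; exact hn2 i)
    refine (eLpNorm_add_le ((measurable_partialDeriv j _).sub
      (measurable_partialDeriv j _)).aestronglyMeasurable ((hpd 0).add (hpd 1))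
      (by norm_num)).trans ?_
    calc _ ≤ δ / 9 + (4 * (δ / 9) + 4 * (δ / 9)) :=
          add_le_add (hψ2 j) ((eLpNorm_add_le (hpd 0) (hpd 1) (by norm_num)).trans
            (add_le_add (hle 0) (hle 1)))
      _ = 9 * (δ / 9) := by ring
      _ = δ := ENNReal.mul_div_cancel (by norm_num) (by norm_num)

theorem abs_integral_mul_le {α : Type*} [MeasurableSpace α] {μ : Measure α} {f g : α → ℝ}
    (hf : MemLp f 2 μ) (hg : MemLp g 2 μ) :
    ∫ x, |f x| * |g x| ∂μ ≤ √(∫ x, f x ^ 2 ∂μ) * √(∫ x, g x ^ 2 ∂μ) := by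
  have h := integral_mul_norm_le_Lp_mul_Lq (μ := μ) (f := f) (g := g)
    (p := 2) (q := 2) Real.HolderConjugate.two_two (by simpa using hf) (by simpa using hg)
  simpa [Real.sqrt_eq_rpow] using h

theorem normL2_nonneg (Ω : Set Plane) (q : Plane → ℝ) : 0 ≤ normL2 Ω q := Real.sqrt_nonneg _

theorem normL2_le_seminormH1 (Ω : Set Plane) (G : Fin 2 → Fin 2 → Plane → ℝ) (k j : Fin 2) :
    normL2 Ω (G k j) ≤ seminormH1 Ω G := by
  refine Real.sqrt_le_sqrt ?_
  have h0 : ∀ k j, 0 ≤ ∫ x in Ω, G k j x ^ 2 := fun k j => integral_nonneg fun x => sq_nonneg _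
  calc ∫ x in Ω, G k j x ^ 2 ≤ ∑ j, ∫ x in Ω, G k j x ^ 2 :=
        Finset.single_le_sum (f := fun j => ∫ x in Ω, G k j x ^ 2) (fun j _ => h0 k j)
          (Finset.mem_univ j)
    _ ≤ _ := Finset.single_le_sum (f := fun k => ∑ j, ∫ x in Ω, G k j x ^ 2)
        (fun k _ => Finset.sum_nonneg fun j _ => h0 k j) (Finset.mem_univ k)

theorem abs_le_two_of_mem_quotients {Ω : Set Plane} {q : Plane → ℝ} (hq : MemL20 Ω q)
    {s : ℝ} (hs : s ∈ quotients Ω q) : |s| ≤ 2 := by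
  obtain ⟨v, G, hv, hpos, rfl⟩ := hs
  have hint : ∀ k, Integrable (fun x => G k k x * q x) (volume.restrict Ω) := fun k =>
    ((hv k).memLp_grad k).integrable_mul hq.1
  have hk : ∀ k, |∫ x in Ω, G k k x * q x| ≤ seminormH1 Ω G * normL2 Ω q := by
    intro k
    calc |∫ x in Ω, G k k x * q x| ≤ ∫ x in Ω, |G k k x * q x| := abs_integral_le_integral_abs
      _ = ∫ x in Ω, |G k k x| * |q x| := by simp_rw [abs_mul]
      _ ≤ normL2 Ω (G k k) * normL2 Ω q := abs_integral_mul_le ((hv k).memLp_grad k) hq.1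
      _ ≤ _ := mul_le_mul_of_nonneg_right (normL2_le_seminormH1 Ω G k k) (normL2_nonneg _ _)
  have e : ∫ x in Ω, (∑ k, G k k x) * q x =
      (∫ x in Ω, G 0 0 x * q x) + ∫ x in Ω, G 1 1 x * q x := by
    rw [← integral_add (hint 0) (hint 1)]
    refine integral_congr_ae (Eventually.of_forall fun x => ?_)
    simp only [Fin.sum_univ_two]
    ring
  rw [e, abs_div, abs_of_nonneg (mul_nonneg hpos.le (normL2_nonneg Ω q))]
  refine div_le_of_le_mul₀ (mul_nonneg hpos.le (normL2_nonneg Ω q)) (by norm_num) ?_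
  linarith [abs_add_le (∫ x in Ω, G 0 0 x * q x) (∫ x in Ω, G 1 1 x * q x), hk 0, hk 1]

theorem IsTestFunction.neg {Ω : Set Plane} {φ : Plane → ℝ} (h : IsTestFunction Ω φ) :
    IsTestFunction Ω fun x => -φ x := by
  refine ⟨h.1.neg, h.2.1.neg, ?_⟩
  have : tsupport (fun x => -φ x) = tsupport φ := by
    unfold tsupport
    rw [Function.support_fun_neg]
  rw [this]
  exact h.2.2

theorem MemH10.neg {Ω : Set Plane} {v : Plane → ℝ} {G : Fin 2 → Plane → ℝ} (h : MemH10 Ω v G) :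
    MemH10 Ω (fun x => -v x) fun j x => -G j x := by
  obtain ⟨φ, h1, h2, h3⟩ := h.approx
  refine ⟨h.memLp.neg, fun j => (h.memLp_grad j).neg, fun n x => -φ n x, fun n => (h1 n).neg,
    h2.congr fun n => ?_, fun j => (h3 j).congr fun n => ?_⟩
  · rw [← eLpNorm_neg]
    congr 1
    ext x
    simp only [Pi.neg_apply]
    ring
  · rw [← eLpNorm_neg]
    congr 1
    ext x
    have : partialDeriv j (fun x => -φ n x) x = -partialDeriv j (φ n) x := by
      simp [partialDeriv, fderiv_fun_neg]
    rw [this]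
    simp only [Pi.neg_apply]
    ring

theorem neg_mem_quotients {Ω : Set Plane} {q : Plane → ℝ} {s : ℝ} (hs : s ∈ quotients Ω q) :
    -s ∈ quotients Ω q := by
  obtain ⟨v, G, hv, hpos, rfl⟩ := hs
  have e : seminormH1 Ω (fun k j x => -G k j x) = seminormH1 Ω G := by simp [seminormH1]
  refine ⟨fun k x => -v k x, fun k j x => -G k j x, fun k => (hv k).neg, by rwa [e], ?_⟩
  rw [e, ← neg_div, ← integral_neg]
  congr 2
  ext x
  simp only [Fin.sum_univ_two]
  ring

theorem bddAbove_quotients {Ω : Set Plane} {q : Plane → ℝ} (hq : MemL20 Ω q) :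
    BddAbove (quotients Ω q) :=
  ⟨2, fun _ hs => (abs_le.1 (abs_le_two_of_mem_quotients hq hs)).2⟩

theorem sSup_quotients_nonneg {Ω : Set Plane} {q : Plane → ℝ} (hq : MemL20 Ω q) :
    0 ≤ sSup (quotients Ω q) := by
  rcases (quotients Ω q).eq_empty_or_nonempty with h | ⟨s, hs⟩
  · rw [h, Real.sSup_empty]
  · rcases le_total 0 s with h0 | h0
    · exact h0.trans (le_csSup (bddAbove_quotients hq) hs)
    · exact (neg_nonneg.2 h0).trans (le_csSup (bddAbove_quotients hq) (neg_mem_quotients hs))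

theorem sSup_quotients_le_two {Ω : Set Plane} {q : Plane → ℝ} (hq : MemL20 Ω q) :
    sSup (quotients Ω q) ≤ 2 :=
  Real.sSup_le (fun _ hs => (abs_le.1 (abs_le_two_of_mem_quotients hq hs)).2) (by norm_num)

theorem beta_nonneg (Ω : Set Plane) : 0 ≤ beta Ω := by
  refine Real.sInf_nonneg ?_
  rintro _ ⟨q, hq, -, rfl⟩
  exact sSup_quotients_nonneg hq

theorem beta_le_sSup {Ω : Set Plane} {q : Plane → ℝ} (hq : MemL20 Ω q) (hpos : 0 < normL2 Ω q) :
    beta Ω ≤ sSup (quotients Ω q) := by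
  refine csInf_le ⟨0, ?_⟩ ⟨q, hq, hpos, rfl⟩
  rintro _ ⟨q, hq, -, rfl⟩
  exact sSup_quotients_nonneg hq

theorem beta_le_two (Ω : Set Plane) : beta Ω ≤ 2 := by
  by_cases h : ∃ q, MemL20 Ω q ∧ 0 < normL2 Ω q
  · obtain ⟨q, hq, hpos⟩ := h
    exact (beta_le_sSup hq hpos).trans (sSup_quotients_le_two hq)
  · have : {r | ∃ q : Plane → ℝ, MemL20 Ω q ∧ 0 < normL2 Ω q ∧ r = sSup (quotients Ω q)} = ∅ := by
      rw [eq_empty_iff_forall_notMem]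
      rintro r ⟨q, hq, hpos, -⟩
      exact h ⟨q, hq, hpos⟩
    rw [beta, this, Real.sInf_empty]
    norm_num

/-- If every admissible `q` on `Ω` has a counterpart on `Ω'` with almost as small a supremum, then
`β` of `Ω` is almost bounded below by `β` of `Ω'`. -/
theorem beta_le_beta_add {Ω Ω' : Set Plane} {δ : ℝ} (hδ : 0 ≤ δ)
    (hne : (∃ q, MemL20 Ω' q ∧ 0 < normL2 Ω' q) → ∃ q, MemL20 Ω q ∧ 0 < normL2 Ω q)
    (h : ∀ q, MemL20 Ω q → 0 < normL2 Ω q → ∃ q', MemL20 Ω' q' ∧ 0 < normL2 Ω' q' ∧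
      sSup (quotients Ω' q') ≤ sSup (quotients Ω q) + δ) : beta Ω' ≤ beta Ω + δ := by
  by_cases h1 : ∃ q, MemL20 Ω q ∧ 0 < normL2 Ω q
  · obtain ⟨q₀, hq₀, hpos₀⟩ := h1
    rw [← sub_le_iff_le_add]
    refine le_csInf ⟨_, q₀, hq₀, hpos₀, rfl⟩ ?_
    rintro _ ⟨q, hq, hpos, rfl⟩
    obtain ⟨q', hq', hpos', hle⟩ := h q hq hpos
    linarith [beta_le_sSup hq' hpos']
  · have h2 : {r | ∃ q : Plane → ℝ, MemL20 Ω' q ∧ 0 < normL2 Ω' q ∧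
        r = sSup (quotients Ω' q)} = ∅ := by
      rw [eq_empty_iff_forall_notMem]
      rintro r ⟨q, hq, hpos, -⟩
      exact h1 (hne ⟨q, hq, hpos⟩)
    have h3 : beta Ω' = 0 := by rw [beta, h2, Real.sInf_empty]
    linarith [beta_nonneg Ω]

theorem row_mul_bounds {ε r s a b c d : ℝ} (hε : ε ≤ 1 / 16) (ha : |a - 1| ≤ ε) (hb : |b| ≤ ε)
    (hc : |c| ≤ ε) (hd : |d - 1| ≤ ε) :
    (1 - 5 * ε) * (r ^ 2 + s ^ 2) ≤ (r * a + s * c) ^ 2 + (r * b + s * d) ^ 2 ∧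
      (r * a + s * c) ^ 2 + (r * b + s * d) ^ 2 ≤ (1 + 5 * ε) * (r ^ 2 + s ^ 2) := by
  have hε0 : 0 ≤ ε := (abs_nonneg _).trans hb
  obtain ⟨a, rfl⟩ : ∃ a', a = a' + 1 := ⟨a - 1, by ring⟩
  obtain ⟨d, rfl⟩ : ∃ d', d = d' + 1 := ⟨d - 1, by ring⟩
  rw [add_sub_cancel_right] at ha hd
  have h1 : |r ^ 2 * a| ≤ r ^ 2 * ε := by
    rw [abs_mul, abs_of_nonneg (sq_nonneg r)]; gcongr
  have h2 : |s ^ 2 * d| ≤ s ^ 2 * ε := by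
    rw [abs_mul, abs_of_nonneg (sq_nonneg s)]; gcongr
  have hrs : |r * s| ≤ (r ^ 2 + s ^ 2) / 2 := by
    rw [abs_le]; constructor <;> nlinarith [sq_nonneg (r + s), sq_nonneg (r - s)]
  have h3 : |r * s * (b + c)| ≤ (r ^ 2 + s ^ 2) * ε := by
    rw [abs_mul]
    calc _ ≤ (r ^ 2 + s ^ 2) / 2 * (ε + ε) := by
          gcongr
          exact (abs_add_le b c).trans (add_le_add hb hc)
      _ = _ := by ring
  have hsq : ∀ x y : ℝ, |x| ≤ ε → |y| ≤ ε →
      (r * x + s * y) ^ 2 ≤ (r ^ 2 + s ^ 2) * ε / 8 := by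
    intro x y hx hy
    have hx2 : x ^ 2 ≤ ε / 16 := by
      have := sq_le_sq' (abs_le.1 hx).1 (abs_le.1 hx).2
      nlinarith
    have hy2 : y ^ 2 ≤ ε / 16 := by
      have := sq_le_sq' (abs_le.1 hy).1 (abs_le.1 hy).2
      nlinarith
    calc (r * x + s * y) ^ 2 ≤ (r ^ 2 + s ^ 2) * (x ^ 2 + y ^ 2) := by
          nlinarith [sq_nonneg (r * y - s * x)]
      _ ≤ (r ^ 2 + s ^ 2) * (ε / 16 + ε / 16) := by gcongr
      _ = _ := by ring
  have h4 := hsq a c ha hc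
  have h5 := hsq b d hb hd
  have h6 := sq_nonneg (r * a + s * c)
  have h7 := sq_nonneg (r * b + s * d)
  rw [abs_le] at h1 h2 h3
  have e : (r * (a + 1) + s * c) ^ 2 + (r * b + s * (d + 1)) ^ 2 = r ^ 2 + s ^ 2 +
      2 * (r ^ 2 * a + s ^ 2 * d + r * s * (b + c)) + (r * a + s * c) ^ 2 +
      (r * b + s * d) ^ 2 := by ring
  have hS : 0 ≤ (r ^ 2 + s ^ 2) * ε := by positivity
  rw [e]
  constructor <;> nlinarith

theorem sqrt_le_of_sq_bounds {x y c C : ℝ} (hc : 0 ≤ c) (hC : 0 ≤ C)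
    (h1 : c ^ 2 * y ≤ x) (h2 : x ≤ C ^ 2 * y) : c * √y ≤ √x ∧ √x ≤ C * √y := by
  constructor
  · rw [← Real.sqrt_sq hc, ← Real.sqrt_mul (sq_nonneg c)]
    exact Real.sqrt_le_sqrt h1
  · rw [← Real.sqrt_sq hC, ← Real.sqrt_mul (sq_nonneg C)]
    exact Real.sqrt_le_sqrt h2

theorem seminormH1_eq {Ω : Set Plane} {G : Fin 2 → Fin 2 → Plane → ℝ}
    (hG : ∀ k j, MemLp (G k j) 2 (volume.restrict Ω)) :
    seminormH1 Ω G = √(∫ x in Ω, ∑ k, ∑ j, G k j x ^ 2) := by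
  unfold seminormH1
  congr 1
  rw [integral_finsetSum _ fun k _ => integrable_finsetSum _ fun j _ => (hG k j).integrable_sq]
  refine Finset.sum_congr rfl fun k _ => ?_
  rw [integral_finsetSum _ fun j _ => (hG k j).integrable_sq]

namespace NearIdEquiv

variable {ε : ℝ≥0} {H : Plane ≃ₜ Plane} {V U : Set Plane}

theorem integrable_absDet_mul (h : NearIdEquiv ε H V U) {f : Plane → ℝ}
    (hf : Integrable f (volume.restrict V)) :
    Integrable (fun x => absDet H x * f x) (volume.restrict V) := by
  refine hf.bdd_mul (c := 2) (measurable_absDet H).aestronglyMeasurable (ae_restrict_of_ae ?_)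
  filter_upwards [h.absDet_le_two] with x hx
  rwa [Real.norm_of_nonneg (absDet_nonneg H x)]

theorem integral_absDet_mul_bounds (h : NearIdEquiv ε H V U) {f : Plane → ℝ}
    (hf : Integrable f (volume.restrict V)) (h0 : ∀ x, 0 ≤ f x) :
    (1 - 3 * (ε : ℝ)) * ∫ x in V, f x ≤ ∫ x in V, absDet H x * f x ∧
      ∫ x in V, absDet H x * f x ≤ (1 + 3 * (ε : ℝ)) * ∫ x in V, f x := by
  rw [← integral_const_mul, ← integral_const_mul]
  constructor
  · refine integral_mono_ae (hf.const_mul _) (h.integrable_absDet_mul hf) (ae_restrict_of_ae ?_)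
    filter_upwards [h.absDet_bounds] with x hx
    exact mul_le_mul_of_nonneg_right hx.1 (h0 x)
  · refine integral_mono_ae (h.integrable_absDet_mul hf) (hf.const_mul _) (ae_restrict_of_ae ?_)
    filter_upwards [h.absDet_bounds] with x hx
    exact mul_le_mul_of_nonneg_right hx.2 (h0 x)

/-- The density on `V` that corresponds to the density `q` on `U`. -/
theorem memL20_pullback (h : NearIdEquiv ε H V U) {q : Plane → ℝ} (hq : MemL20 U q) :
    MemL20 V fun x => absDet H x * q (H x) := by
  constructor
  · have h1 : MemLp (fun x => q (H x)) 2 (volume.restrict V) := h.symm.memLp_comp_symm hq.1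
    refine h1.of_le_mul (c := 2) ((measurable_absDet H).aestronglyMeasurable.mul h1.1)
      (ae_restrict_of_ae ?_)
    filter_upwards [h.absDet_le_two] with x hx
    rw [norm_mul, Real.norm_of_nonneg (absDet_nonneg H x)]
    gcongr
  · rw [← h.integral_eq]
    exact hq.2

theorem normL2_pullback (h : NearIdEquiv ε H V U) {q : Plane → ℝ} (hq : MemL20 U q) :
    (1 - 3 * (ε : ℝ)) * normL2 U q ≤ normL2 V (fun x => absDet H x * q (H x)) ∧
      normL2 V (fun x => absDet H x * q (H x)) ≤ (1 + 3 * (ε : ℝ)) * normL2 U q := by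
  have h1 : MemLp (fun x => q (H x)) 2 (volume.restrict V) := h.symm.memLp_comp_symm hq.1
  have h2 := h.integrable_absDet_mul h1.integrable_sq
  have h3 := h.integral_absDet_mul_bounds h2
    (fun x => mul_nonneg (absDet_nonneg H x) (sq_nonneg (q (H x))))
  have e1 : ∫ x in U, q x ^ 2 = ∫ x in V, absDet H x * q (H x) ^ 2 := h.integral_eq _
  have e2 : ∫ x in V, (absDet H x * q (H x)) ^ 2 =
      ∫ x in V, absDet H x * (absDet H x * q (H x) ^ 2) := by
    congr 1; ext x; ring
  have hI : 0 ≤ ∫ x in U, q x ^ 2 := integral_nonneg fun x => sq_nonneg _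
  have hε := h.eps_le
  have hε0 : (0 : ℝ) ≤ ε := ε.2
  rw [← e1] at h3
  unfold normL2
  rw [e2]
  refine sqrt_le_of_sq_bounds (by linarith) (by linarith) (le_trans ?_ h3.1) (h3.2.trans ?_)
  · gcongr; nlinarith
  · gcongr; nlinarith

theorem seminormH1_pushforward (h : NearIdEquiv ε H V U) {G : Fin 2 → Fin 2 → Plane → ℝ}
    (hG : ∀ k j, MemLp (G k j) 2 (volume.restrict V)) :
    (1 - 8 * (ε : ℝ)) * seminormH1 V G ≤
        seminormH1 U (fun k j x => ∑ i, G k i (H.symm x) * jac H.symm x i j) ∧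
      seminormH1 U (fun k j x => ∑ i, G k i (H.symm x) * jac H.symm x i j) ≤
        (1 + 5 * (ε : ℝ)) * seminormH1 V G := by
  have hG' : ∀ k j, MemLp (fun x => ∑ i, G k i (H.symm x) * jac H.symm x i j) 2
      (volume.restrict U) := fun k j =>
    memLp_finsetSum _ fun i _ => h.memLp_comp_symm_mul_jac (hG k i) i j
  have hgi : Integrable (fun x => ∑ k, ∑ j, G k j x ^ 2) (volume.restrict V) :=
    integrable_finsetSum _ fun k _ => integrable_finsetSum _ fun j _ => (hG k j).integrable_sq
  have hgU : Integrable (fun x => ∑ k, ∑ j, G k j (H.symm x) ^ 2) (volume.restrict U) :=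
    integrable_finsetSum _ fun k _ => integrable_finsetSum _ fun j _ =>
      (h.memLp_comp_symm (hG k j)).integrable_sq
  have hGi : Integrable (fun x => ∑ k, ∑ j, (∑ i, G k i (H.symm x) * jac H.symm x i j) ^ 2)
      (volume.restrict U) :=
    integrable_finsetSum _ fun k _ => integrable_finsetSum _ fun j _ => (hG' k j).integrable_sq
  have e1 : ∫ x in U, ∑ k, ∑ j, G k j (H.symm x) ^ 2 =
      ∫ x in V, absDet H x * ∑ k, ∑ j, G k j x ^ 2 := by
    rw [h.integral_eq]
    simp
  have hb := h.integral_absDet_mul_bounds hgi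
    (fun x => Finset.sum_nonneg fun k _ => Finset.sum_nonneg fun j _ => sq_nonneg _)
  rw [← e1] at hb
  have hε := h.eps_le
  have hε0 : (0 : ℝ) ≤ ε := ε.2
  have hpt : ∀ᵐ x, (1 - 5 * (ε : ℝ)) * (∑ k, ∑ j, G k j (H.symm x) ^ 2) ≤
        ∑ k, ∑ j, (∑ i, G k i (H.symm x) * jac H.symm x i j) ^ 2 ∧
      ∑ k, ∑ j, (∑ i, G k i (H.symm x) * jac H.symm x i j) ^ 2 ≤
        (1 + 5 * (ε : ℝ)) * (∑ k, ∑ j, G k j (H.symm x) ^ 2) := by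
    filter_upwards [h.abs_jac_symm_sub_le] with x hx
    have h00 := hx 0 0
    have h01 := hx 0 1
    have h10 := hx 1 0
    have h11 := hx 1 1
    simp only [Fin.isValue, if_true, zero_ne_one, one_ne_zero, if_false, sub_zero]
      at h00 h01 h10 h11
    have r0 := row_mul_bounds (r := G 0 0 (H.symm x)) (s := G 0 1 (H.symm x)) hε h00 h01 h10 h11
    have r1 := row_mul_bounds (r := G 1 0 (H.symm x)) (s := G 1 1 (H.symm x)) hε h00 h01 h10 h11
    simp only [Fin.sum_univ_two]
    constructor <;> linarith [r0.1, r0.2, r1.1, r1.2]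
  have hlow := integral_mono_ae (hgU.const_mul (1 - 5 * (ε : ℝ))) hGi
    (ae_restrict_of_ae (hpt.mono fun x hx => hx.1))
  have hup := integral_mono_ae hGi (hgU.const_mul (1 + 5 * (ε : ℝ)))
    (ae_restrict_of_ae (hpt.mono fun x hx => hx.2))
  simp only [integral_const_mul] at hlow hup
  have hI : 0 ≤ ∫ x in V, ∑ k, ∑ j, G k j x ^ 2 := integral_nonneg fun x =>
    Finset.sum_nonneg fun k _ => Finset.sum_nonneg fun j _ => sq_nonneg _
  rw [seminormH1_eq hG, seminormH1_eq hG']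
  refine sqrt_le_of_sq_bounds (by linarith) (by linarith) (le_trans ?_ hlow) (hup.trans ?_)
  · calc _ ≤ (1 - 5 * (ε : ℝ)) * ((1 - 3 * (ε : ℝ)) * ∫ x in V, ∑ k, ∑ j, G k j x ^ 2) := by
          rw [← mul_assoc]
          gcongr
          nlinarith
      _ ≤ _ := mul_le_mul_of_nonneg_left hb.1 (by linarith)
  · calc _ ≤ (1 + 5 * (ε : ℝ)) * ((1 + 3 * (ε : ℝ)) * ∫ x in V, ∑ k, ∑ j, G k j x ^ 2) :=
          mul_le_mul_of_nonneg_left hb.2 (by linarith)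
      _ ≤ _ := by
          rw [← mul_assoc]
          gcongr
          nlinarith

theorem abs_integral_div_sub_le (h : NearIdEquiv ε H V U) {G : Fin 2 → Fin 2 → Plane → ℝ}
    (hG : ∀ k j, MemLp (G k j) 2 (volume.restrict V)) {q : Plane → ℝ} (hq : MemL20 U q) :
    |(∫ x in U, (∑ k, ∑ i, G k i (H.symm x) * jac H.symm x i k) * q x) -
      ∫ x in V, (∑ k, G k k x) * (absDet H x * q (H x))| ≤
      5 * ε * seminormH1 V G * normL2 U q := by
  have hε := h.eps_le
  have hε0 : (0 : ℝ) ≤ ε := ε.2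
  have hK : ∀ k i, MemLp (fun x => G k i (H.symm x)) 2 (volume.restrict U) := fun k i =>
    h.memLp_comp_symm (hG k i)
  have e1 : ∫ x in V, (∑ k, G k k x) * (absDet H x * q (H x)) =
      ∫ x in U, (∑ k, G k k (H.symm x)) * q x := by
    rw [h.integral_eq]
    congr 1
    ext x
    simp only [Homeomorph.symm_apply_apply]
    ring
  have hi1 : Integrable (fun x => (∑ k, ∑ i, G k i (H.symm x) * jac H.symm x i k) * q x)
      (volume.restrict U) :=
    (memLp_finsetSum _ fun k _ => memLp_finsetSum _ fun i _ =>
      h.memLp_comp_symm_mul_jac (hG k i) i k).integrable_mul hq.1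
  have hi2 : Integrable (fun x => (∑ k, G k k (H.symm x)) * q x) (volume.restrict U) :=
    (memLp_finsetSum _ fun k _ => hK k k).integrable_mul hq.1
  have hi3 : ∀ k i, Integrable (fun x => |G k i (H.symm x)| * |q x|) (volume.restrict U) :=
    fun k i => (hK k i).abs.integrable_mul hq.1.abs
  have hCS : ∀ k i, ∫ x in U, |G k i (H.symm x)| * |q x| ≤
      5 / 4 * seminormH1 V G * normL2 U q := by
    intro k i
    refine (abs_integral_mul_le (hK k i) hq.1).trans ?_
    refine mul_le_mul_of_nonneg_right ?_ (normL2_nonneg _ _)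
    have e2 : ∫ x in U, G k i (H.symm x) ^ 2 = ∫ x in V, absDet H x * G k i x ^ 2 := by
      rw [h.integral_eq]; simp
    have hb := (h.integral_absDet_mul_bounds (hG k i).integrable_sq fun x => sq_nonneg _).2
    have hI : 0 ≤ ∫ x in V, G k i x ^ 2 := integral_nonneg fun x => sq_nonneg _
    have := (sqrt_le_of_sq_bounds (x := ∫ x in U, G k i (H.symm x) ^ 2)
      (y := ∫ x in V, G k i x ^ 2) (c := 0) (C := 5 / 4) le_rfl (by norm_num)
      (by rw [e2]; simpa using integral_nonneg fun x =>
            mul_nonneg (absDet_nonneg H x) (sq_nonneg (G k i x)))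
      (by rw [e2]; refine hb.trans ?_; gcongr; nlinarith)).2
    exact this.trans (mul_le_mul_of_nonneg_left (normL2_le_seminormH1 V G k i) (by norm_num))
  rw [e1, ← integral_sub hi1 hi2]
  have hpt : ∀ᵐ x, ‖(∑ k, ∑ i, G k i (H.symm x) * jac H.symm x i k) * q x -
      (∑ k, G k k (H.symm x)) * q x‖ ≤ ε * ∑ k, ∑ i, |G k i (H.symm x)| * |q x| := by
    filter_upwards [h.abs_jac_symm_sub_le] with x hx
    have e3 : (∑ k, ∑ i, G k i (H.symm x) * jac H.symm x i k) * q x -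
        (∑ k, G k k (H.symm x)) * q x = ∑ k, ∑ i, G k i (H.symm x) *
          (jac H.symm x i k - if i = k then 1 else 0) * q x := by
      simp only [Fin.sum_univ_two, Fin.isValue, if_true, zero_ne_one, one_ne_zero, if_false]
      ring
    rw [e3, Finset.mul_sum]
    refine (norm_sum_le _ _).trans (Finset.sum_le_sum fun k _ => ?_)
    rw [Finset.mul_sum]
    refine (norm_sum_le _ _).trans (Finset.sum_le_sum fun i _ => ?_)
    rw [norm_mul, norm_mul, Real.norm_eq_abs, Real.norm_eq_abs, Real.norm_eq_abs]
    calc _ ≤ |G k i (H.symm x)| * ε * |q x| := by gcongr; exact hx i k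
      _ = _ := by ring
  have hsi : Integrable (fun x => ∑ k, ∑ i, |G k i (H.symm x)| * |q x|) (volume.restrict U) :=
    integrable_finsetSum _ fun k _ => integrable_finsetSum _ fun i _ => hi3 k i
  refine (norm_integral_le_of_norm_le (hsi.const_mul _) (ae_restrict_of_ae hpt)).trans ?_
  rw [integral_const_mul, integral_finsetSum _ fun k _ => integrable_finsetSum _ fun i _ => hi3 k i]
  simp_rw [fun k => integral_finsetSum (μ := volume.restrict U) Finset.univ
    (f := fun i x => |G k i (H.symm x)| * |q x|) fun i _ => hi3 k i]
  simp only [Fin.sum_univ_two]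
  calc _ ≤ (ε : ℝ) * (4 * (5 / 4 * seminormH1 V G * normL2 U q)) := by
        refine mul_le_mul_of_nonneg_left ?_ hε0
        linarith [hCS 0 0, hCS 0 1, hCS 1 0, hCS 1 1]
    _ = _ := by ring

theorem sSup_quotients_pullback_le (h : NearIdEquiv ε H V U) {q : Plane → ℝ} (hq : MemL20 U q)
    (hpos : 0 < normL2 U q) :
    sSup (quotients V fun x => absDet H x * q (H x)) ≤ sSup (quotients U q) + 21 * ε := by
  have hε := h.eps_le
  have hε0 : (0 : ℝ) ≤ ε := ε.2
  have hnn := sSup_quotients_nonneg hq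
  refine Real.sSup_le (fun s' hs' => ?_) (by positivity)
  rcases le_total s' (11 * ε) with hsm | hlarge
  · linarith
  have hs2 := (abs_le.1 (abs_le_two_of_mem_quotients (h.memL20_pullback hq) hs')).2
  obtain ⟨v, G, hv, ha', hs'⟩ := hs'
  have hG : ∀ k j, MemLp (G k j) 2 (volume.restrict V) := fun k j => (hv k).memLp_grad j
  have hD := h.abs_integral_div_sub_le hG hq
  obtain ⟨hal, hau⟩ := h.seminormH1_pushforward hG
  obtain ⟨hbl, hbu⟩ := h.normL2_pullback hq
  set a := seminormH1 U (fun k j x => ∑ i, G k i (H.symm x) * jac H.symm x i j) with ha_def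
  set a' := seminormH1 V G
  set b := normL2 U q
  set b' := normL2 V (fun x => absDet H x * q (H x))
  set D := ∫ x in U, (∑ k, ∑ i, G k i (H.symm x) * jac H.symm x i k) * q x with hD_def
  set D' := ∫ x in V, (∑ k, G k k x) * (absDet H x * q (H x))
  have ha : 0 < a := lt_of_lt_of_le (mul_pos (by linarith) ha') hal
  have hb' : 0 < b' := lt_of_lt_of_le (mul_pos (by linarith) hpos) hbl
  have hmem : D / (a * b) ∈ quotients U q :=
    ⟨fun k x => v k (H.symm x), fun k j x => ∑ i, G k i (H.symm x) * jac H.symm x i j,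
      fun k => h.memH10_comp_symm (hv k), ha, rfl⟩
  have hle := le_csSup (bddAbove_quotients hq) hmem
  have hD' : D' = s' * (a' * b') := by
    rw [hs']; field_simp
  have hab : 0 < a' * b := mul_pos ha' hpos
  have h1 : a' * b * (s' - 11 * ε) ≤ D := by
    have h2 : s' * (a' * ((1 - 3 * ε) * b)) ≤ s' * (a' * b') := by
      have : 0 ≤ s' := by linarith
      gcongr
    have h3 := (abs_le.1 hD).1
    have h4 : a' * b * (s' - 11 * ε) ≤ a' * b * (s' * (1 - 3 * ε) - 5 * ε) :=
      mul_le_mul_of_nonneg_left (by nlinarith) hab.le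
    nlinarith
  have h5 : s' - 21 * ε ≤ D / (a * b) := by
    rw [le_div_iff₀ (mul_pos ha hpos)]
    rcases le_total (s' - 21 * ε) 0 with h6 | h6
    · refine (mul_nonpos_of_nonpos_of_nonneg h6 (mul_pos ha hpos).le).trans (le_trans ?_ h1)
      exact mul_nonneg hab.le (by linarith)
    · calc (s' - 21 * ε) * (a * b) ≤ (s' - 21 * ε) * ((1 + 5 * ε) * a' * b) := by gcongr
        _ = a' * b * ((s' - 21 * ε) * (1 + 5 * ε)) := by ring
        _ ≤ a' * b * (s' - 11 * ε) := by
            gcongr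
            nlinarith
        _ ≤ D := h1
  linarith

theorem beta_le (h : NearIdEquiv ε H V U) : beta V ≤ beta U + 21 * ε := by
  have hε := h.eps_le
  have hpull : ∀ {H : Plane ≃ₜ Plane} {V U : Set Plane} (_ : NearIdEquiv ε H V U) {q : Plane → ℝ},
      MemL20 U q → 0 < normL2 U q → 0 < normL2 V (fun x => absDet H x * q (H x)) :=
    fun h q hq hpos => lt_of_lt_of_le (mul_pos (by linarith) hpos) (h.normL2_pullback hq).1
  refine beta_le_beta_add (by positivity) ?_ fun q hq hpos =>
    ⟨_, h.memL20_pullback hq, hpull h hq hpos, h.sSup_quotients_pullback_le hq hpos⟩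
  rintro ⟨q, hq, hpos⟩
  exact ⟨_, h.symm.memL20_pullback hq, hpull h.symm hq hpos⟩

theorem abs_beta_sub_le (h : NearIdEquiv ε H V U) : |beta V - beta U| ≤ 21 * ε := by
  rw [abs_le]
  constructor <;> linarith [h.beta_le, h.symm.beta_le]

end NearIdEquiv

/-- A nondegenerate pair of directions, no nonnegative combination of which vanishes. -/
theorem exists_le_norm_combination {E : Type*} [NormedAddCommGroup E] [NormedSpace ℝ E] {u v : E}
    (hu : u ≠ 0) (hv : v ≠ 0) (h : ¬ SameRay ℝ u (-v)) :
    ∃ c > 0, ∀ α β : ℝ, 0 ≤ α → 0 ≤ β → c * (α + β) ≤ ‖α • u + β • v‖ := by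
  have hne : ∀ θ ∈ Icc (0 : ℝ) 1, 0 < ‖θ • u + (1 - θ) • v‖ := by
    intro θ hθ
    rw [norm_pos_iff]
    intro h0
    rcases hθ.1.eq_or_lt with h1 | h1
    · subst h1; simp at h0; exact hv h0
    rcases hθ.2.eq_or_lt with h2 | h2
    · subst h2; simp at h0; exact hu h0
    refine h (Or.inr (Or.inr ⟨θ, 1 - θ, h1, by linarith, ?_⟩))
    rw [smul_neg]
    exact eq_neg_of_add_eq_zero_left h0
  obtain ⟨θ₀, hθ₀, hmin⟩ := isCompact_Icc.exists_isMinOn (nonempty_Icc.2 (zero_le_one' ℝ))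
    (f := fun θ : ℝ => ‖θ • u + (1 - θ) • v‖) (by fun_prop)
  refine ⟨_, hne θ₀ hθ₀, fun α β hα hβ => ?_⟩
  rcases (add_nonneg hα hβ).eq_or_lt with h1 | h1
  · rw [← h1, mul_zero]; exact norm_nonneg _
  have h2 := hmin (show α / (α + β) ∈ Icc (0 : ℝ) 1 from
    ⟨by positivity, (div_le_one h1).2 (by linarith)⟩)
  have h3 : α • u + β • v = (α + β) • ((α / (α + β)) • u + (1 - α / (α + β)) • v) := by
    rw [smul_add, smul_smul, smul_smul]
    congr 2 <;> field_simp
    ring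
  rw [h3, norm_smul, Real.norm_of_nonneg h1.le, mul_comm]
  exact mul_le_mul_of_nonneg_left h2 h1.le

theorem exists_norm_sub_sub_smul_derivWithin_le {γ : ℝ → Plane} {p q : ℝ} (hpq : p < q)
    (hγ : ContDiffOn ℝ 2 γ (Icc p q)) :
    ∃ M ≥ 0, ∀ a b x y z, p ≤ a → b ≤ q → x ∈ Icc a b → y ∈ Icc a b → z ∈ Icc a b →
      ‖γ y - γ x - (y - x) • derivWithin γ (Icc p q) z‖ ≤ M * (b - a) * |y - x| := by
  have hU := uniqueDiffOn_Icc hpq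
  have h1 : ContDiffOn ℝ 1 (derivWithin γ (Icc p q)) (Icc p q) :=
    hγ.derivWithin hU (by norm_num)
  have h2 : ContinuousOn (derivWithin (derivWithin γ (Icc p q)) (Icc p q)) (Icc p q) :=
    h1.continuousOn_derivWithin hU le_rfl
  obtain ⟨M, hM⟩ := isCompact_Icc.exists_bound_of_continuousOn h2
  have hM0 : 0 ≤ M := (norm_nonneg _).trans (hM p (left_mem_Icc.2 hpq.le))
  refine ⟨M, hM0, fun a b x y z hpa hbq hx hy hz => ?_⟩
  have hsub : Icc a b ⊆ Icc p q := Icc_subset_Icc hpa hbq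
  have h3 : ∀ w ∈ Icc a b, ‖derivWithin γ (Icc p q) w - derivWithin γ (Icc p q) z‖ ≤
      M * (b - a) := by
    intro w hw
    refine ((convex_Icc p q).norm_image_sub_le_of_norm_derivWithin_le
      (h1.differentiableOn one_ne_zero) hM (hsub hz) (hsub hw)).trans ?_
    gcongr
    rw [Real.norm_eq_abs, abs_le]
    constructor <;> linarith [hw.1, hw.2, hz.1, hz.2]
  have h4 : ∀ w ∈ Icc a b, HasDerivWithinAt (fun w => γ w - w • derivWithin γ (Icc p q) z)
      (derivWithin γ (Icc p q) w - derivWithin γ (Icc p q) z) (Icc a b) w := by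
    intro w hw
    have h5 := ((hγ.differentiableOn two_ne_zero) w (hsub hw)).hasDerivWithinAt.mono hsub
    have h6 := (hasDerivWithinAt_id w (Icc a b)).smul_const (derivWithin γ (Icc p q) z)
    rw [one_smul] at h6
    exact h5.sub h6
  have h7 := (convex_Icc a b).norm_image_sub_le_of_norm_hasDerivWithin_le h4 h3 hx hy
  rw [Real.norm_eq_abs] at h7
  refine le_trans (le_of_eq ?_) h7
  congr 1
  rw [sub_smul]
  abel

namespace IsPiecewiseC2Loop

variable {C : Finset Plane} {γ : ℝ → Plane}

theorem map_add_int (h : IsPiecewiseC2Loop (C : Set Plane) γ) (t : ℝ) (n : ℤ) :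
    γ (t + n) = γ t := by
  simpa using h.periodic.int_mul n t

theorem eq_iff (h : IsPiecewiseC2Loop (C : Set Plane) γ) {s t : ℝ} :
    γ s = γ t ↔ ∃ n : ℤ, s = t + n := by
  constructor
  · intro hst
    have h1 : ∀ x, γ (Int.fract x) = γ x := fun x => by
      rw [← h.map_add_int (Int.fract x) ⌊x⌋, Int.fract_add_floor]
    have h2 : Int.fract s = Int.fract t :=
      h.injOn ⟨Int.fract_nonneg s, Int.fract_lt_one s⟩ ⟨Int.fract_nonneg t, Int.fract_lt_one t⟩
        (by rw [h1, h1, hst])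
    refine ⟨⌊s⌋ - ⌊t⌋, ?_⟩
    push_cast
    linarith [Int.fract_add_floor s, Int.fract_add_floor t]
  · rintro ⟨n, rfl⟩
    exact h.map_add_int t n

theorem eq_of_abs_sub_lt_one (h : IsPiecewiseC2Loop (C : Set Plane) γ) {s t : ℝ}
    (hst : γ s = γ t) (hlt : |s - t| < 1) : s = t := by
  obtain ⟨n, rfl⟩ := h.eq_iff.1 hst
  rw [add_sub_cancel_left] at hlt
  have : |n| < 1 := by exact_mod_cast hlt
  rw [Int.abs_lt_one_iff] at this
  simp [this]

theorem exists_isolated (h : IsPiecewiseC2Loop (C : Set Plane) γ) (t₀ : ℝ) :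
    ∃ δ > 0, ∀ t, |t - t₀| < δ → t ≠ t₀ → γ t ∉ (C : Set Plane) := by
  have h1 : ∀ᶠ t in 𝓝 t₀, ∀ p ∈ C, t ≠ t₀ → γ t ≠ p := by
    rw [Finset.eventually_all]
    intro p _
    by_cases hp : γ t₀ = p
    · filter_upwards [Metric.ball_mem_nhds t₀ one_pos] with t ht hne heq
      exact hne (h.eq_of_abs_sub_lt_one (heq.trans hp.symm) ht)
    · filter_upwards [h.continuous.continuousAt.eventually_ne hp] with t ht _
      exact ht
  obtain ⟨δ, hδ, hball⟩ := Metric.eventually_nhds_iff.1 h1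
  exact ⟨δ, hδ, fun t ht hne hmem => hball ht (γ t) hmem hne rfl⟩

/-- On small arcs without interior corner, the arc deviates from its chord to second order, with
the derivative to first order. -/
theorem exists_arc_chord_local (h : IsPiecewiseC2Loop (C : Set Plane) γ) (t₀ : ℝ) :
    ∃ M ≥ 0, ∃ δ > 0, ∀ a b, a < b → a ∈ Ioo (t₀ - δ) (t₀ + δ) → b ∈ Ioo (t₀ - δ) (t₀ + δ) →
      (∀ t ∈ Ioo a b, γ t ∉ (C : Set Plane)) → ∀ s ∈ Icc a b, ∀ t ∈ Icc a b,
      ‖γ t - γ s - ((t - s) / (b - a)) • (γ b - γ a)‖ ≤ M * (b - a) * |t - s| := by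
  obtain ⟨δ, hδ, hiso⟩ := h.exists_isolated t₀
  have key : ∀ p q, p < q → (∀ t ∈ Ioo p q, γ t ∉ (C : Set Plane)) → ∃ M ≥ 0, ∀ a b, a < b →
      p ≤ a → b ≤ q → ∀ s ∈ Icc a b, ∀ t ∈ Icc a b,
      ‖γ t - γ s - ((t - s) / (b - a)) • (γ b - γ a)‖ ≤ M * (b - a) * |t - s| := by
    intro p q hpq hC
    obtain ⟨M, hM0, hM⟩ := exists_norm_sub_sub_smul_derivWithin_le hpq (h.smooth p q hpq hC)
    refine ⟨2 * M, by positivity, fun a b hab hpa hbq s hs t ht => ?_⟩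
    have ha : a ∈ Icc a b := left_mem_Icc.2 hab.le
    have hb : b ∈ Icc a b := right_mem_Icc.2 hab.le
    have h1 := hM a b s t a hpa hbq hs ht ha
    have h2 := hM a b a b a hpa hbq ha hb ha
    set w := derivWithin γ (Icc p q) a
    have hba : 0 < b - a := sub_pos.2 hab
    have e : γ t - γ s - ((t - s) / (b - a)) • (γ b - γ a) =
        (γ t - γ s - (t - s) • w) - ((t - s) / (b - a)) • (γ b - γ a - (b - a) • w) := by
      rw [smul_sub _ (γ b - γ a), smul_smul, div_mul_cancel₀ _ hba.ne']
      abel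
    rw [e]
    refine (norm_sub_le _ _).trans ?_
    rw [norm_smul, Real.norm_eq_abs, abs_div, abs_of_pos hba]
    rw [abs_of_pos hba] at h2
    calc _ ≤ M * (b - a) * |t - s| + |t - s| / (b - a) * (M * (b - a) * (b - a)) := by gcongr
      _ = _ := by field_simp; ring
  obtain ⟨M₁, hM₁0, hM₁⟩ := key (t₀ - δ) t₀ (by linarith) fun t ht =>
    hiso t (by rw [abs_lt]; constructor <;> linarith [ht.1, ht.2]) ht.2.ne
  obtain ⟨M₂, hM₂0, hM₂⟩ := key t₀ (t₀ + δ) (by linarith) fun t ht =>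
    hiso t (by rw [abs_lt]; constructor <;> linarith [ht.1, ht.2]) ht.1.ne'
  by_cases hc : γ t₀ ∈ (C : Set Plane)
  · refine ⟨max M₁ M₂, le_max_of_le_left hM₁0, δ, hδ, fun a b hab ha hb hC s hs t ht => ?_⟩
    have hba : 0 < b - a := sub_pos.2 hab
    rcases le_or_gt b t₀ with h1 | h1
    · refine (hM₁ a b hab ha.1.le h1 s hs t ht).trans ?_
      gcongr
      exact le_max_left _ _
    · rcases le_or_gt t₀ a with h2 | h2
      · refine (hM₂ a b hab h2 hb.2.le s hs t ht).trans ?_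
        gcongr
        exact le_max_right _ _
      · exact absurd hc (hC t₀ ⟨h2, h1⟩)
  · obtain ⟨M, hM0, hM⟩ := key (t₀ - δ) (t₀ + δ) (by linarith) fun t ht => by
      rcases eq_or_ne t t₀ with rfl | hne
      · exact hc
      · exact hiso t (by rw [abs_lt]; constructor <;> linarith [ht.1, ht.2]) hne
    exact ⟨M, hM0, δ, hδ, fun a b hab ha hb _ => hM a b hab ha.1.le hb.2.le⟩

theorem exists_arc_chord (h : IsPiecewiseC2Loop (C : Set Plane) γ) :
    ∃ M ≥ 0, ∃ δ > 0, ∀ a b, a < b → b - a < δ →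
      (∀ t ∈ Ioo a b, γ t ∉ (C : Set Plane)) → ∀ s ∈ Icc a b, ∀ t ∈ Icc a b,
      ‖γ t - γ s - ((t - s) / (b - a)) • (γ b - γ a)‖ ≤ M * (b - a) * |t - s| := by
  have key : ∃ M ≥ 0, ∃ δ > 0, ∀ a ∈ Icc (0 : ℝ) 1, ∀ b, a < b → b - a < δ →
      (∀ t ∈ Ioo a b, γ t ∉ (C : Set Plane)) → ∀ s ∈ Icc a b, ∀ t ∈ Icc a b,
      ‖γ t - γ s - ((t - s) / (b - a)) • (γ b - γ a)‖ ≤ M * (b - a) * |t - s| := by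
    refine isCompact_Icc.induction_on (p := fun A : Set ℝ => ∃ M ≥ (0 : ℝ), ∃ δ > (0 : ℝ),
      ∀ a ∈ A, ∀ b, a < b → b - a < δ → (∀ t ∈ Ioo a b, γ t ∉ (C : Set Plane)) →
      ∀ s ∈ Icc a b, ∀ t ∈ Icc a b,
      ‖γ t - γ s - ((t - s) / (b - a)) • (γ b - γ a)‖ ≤ M * (b - a) * |t - s|)
      ⟨0, le_rfl, 1, one_pos, by simp⟩ ?_ ?_ ?_
    · rintro A B hAB ⟨M, hM, δ, hδ, hB⟩
      exact ⟨M, hM, δ, hδ, fun a ha => hB a (hAB ha)⟩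
    · rintro A B ⟨M, hM, δ, hδ, hA⟩ ⟨M', hM', δ', hδ', hB⟩
      refine ⟨max M M', le_max_of_le_left hM, min δ δ', lt_min hδ hδ', ?_⟩
      intro a ha b hab hlt hC s hs t ht
      have hba : 0 < b - a := sub_pos.2 hab
      rcases ha with ha | ha
      · refine (hA a ha b hab (hlt.trans_le (min_le_left _ _)) hC s hs t ht).trans ?_
        gcongr
        exact le_max_left _ _
      · refine (hB a ha b hab (hlt.trans_le (min_le_right _ _)) hC s hs t ht).trans ?_
        gcongr
        exact le_max_right _ _
    · intro t₀ _
      obtain ⟨M, hM, δ, hδ, hloc⟩ := h.exists_arc_chord_local t₀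
      refine ⟨Ioo (t₀ - δ / 2) (t₀ + δ / 2), mem_nhdsWithin_of_mem_nhds
        (Ioo_mem_nhds (by linarith) (by linarith)), M, hM, δ / 2, by positivity, ?_⟩
      intro a ha b hab hlt
      exact hloc a b hab ⟨by linarith [ha.1], by linarith [ha.2]⟩
        ⟨by linarith [ha.1], by linarith [ha.2]⟩
  obtain ⟨M, hM, δ, hδ, hkey⟩ := key
  refine ⟨M, hM, δ, hδ, fun a b hab hlt hC s hs t ht => ?_⟩
  have hshift : ∀ x, γ (x - ⌊a⌋) = γ x := fun x => by
    have := h.map_add_int x (-⌊a⌋)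
    rwa [Int.cast_neg, ← sub_eq_add_neg] at this
  have := hkey (a - ⌊a⌋) ⟨Int.fract_nonneg a, (Int.fract_lt_one a).le⟩ (b - ⌊a⌋) (by linarith)
    (by linarith) (fun x hx => by
      rw [← h.map_add_int x ⌊a⌋]
      exact hC _ ⟨by linarith [hx.1], by linarith [hx.2]⟩)
    (s - ⌊a⌋) ⟨by linarith [hs.1], by linarith [hs.2]⟩
    (t - ⌊a⌋) ⟨by linarith [ht.1], by linarith [ht.2]⟩
  simpa only [hshift, sub_sub_sub_cancel_right] using this

theorem exists_one_sided (h : IsPiecewiseC2Loop (C : Set Plane) γ) (t₀ : ℝ) :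
    ∃ u v : Plane, u ≠ 0 ∧ v ≠ 0 ∧ ¬ SameRay ℝ u (-v) ∧ ∃ M ≥ 0, ∃ δ > 0,
      (∀ r ≤ δ, ∀ s ∈ Icc t₀ (t₀ + r), ∀ t ∈ Icc t₀ (t₀ + r),
        ‖γ t - γ s - (t - s) • u‖ ≤ M * r * |t - s|) ∧
      (∀ r ≤ δ, ∀ s ∈ Icc (t₀ - r) t₀, ∀ t ∈ Icc (t₀ - r) t₀,
        ‖γ t - γ s - (t - s) • v‖ ≤ M * r * |t - s|) := by
  obtain ⟨δ, hδ, hiso⟩ := h.exists_isolated t₀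
  have h1 : ∀ t ∈ Ioo t₀ (t₀ + δ), γ t ∉ (C : Set Plane) := fun t ht =>
    hiso t (by rw [abs_lt]; constructor <;> linarith [ht.1, ht.2]) ht.1.ne'
  have h2 : ∀ t ∈ Ioo (t₀ - δ) t₀, γ t ∉ (C : Set Plane) := fun t ht =>
    hiso t (by rw [abs_lt]; constructor <;> linarith [ht.1, ht.2]) ht.2.ne
  have hr : t₀ < t₀ + δ := by linarith
  have hl : t₀ - δ < t₀ := by linarith
  obtain ⟨M₁, hM₁0, hM₁⟩ := exists_norm_sub_sub_smul_derivWithin_le hr (h.smooth _ _ hr h1)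
  obtain ⟨M₂, hM₂0, hM₂⟩ := exists_norm_sub_sub_smul_derivWithin_le hl (h.smooth _ _ hl h2)
  set u := derivWithin γ (Icc t₀ (t₀ + δ)) t₀ with hu
  set v := derivWithin γ (Icc (t₀ - δ) t₀) t₀ with hv
  have hu0 : u ≠ 0 := h.regular _ _ hr h1 t₀ (left_mem_Icc.2 hr.le)
  have hv0 : v ≠ 0 := h.regular _ _ hl h2 t₀ (right_mem_Icc.2 hl.le)
  have eu : u = derivWithin γ (Ici t₀) t₀ := by
    rw [hu, ← Ici_inter_Iic, derivWithin_inter (Iic_mem_nhds hr)]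
  have ev : v = derivWithin γ (Iic t₀) t₀ := by
    rw [hv, ← Ici_inter_Iic, inter_comm, derivWithin_inter (Ici_mem_nhds hl)]
  refine ⟨u, v, hu0, hv0, ?_, max M₁ M₂, le_max_of_le_left hM₁0, δ, hδ, ?_, ?_⟩
  · by_cases hc : γ t₀ ∈ (C : Set Plane)
    · rw [eu, ev]
      exact h.no_cusp t₀ hc
    · have h3 : ∀ t ∈ Ioo (t₀ - δ) (t₀ + δ), γ t ∉ (C : Set Plane) := fun t ht => by
        rcases eq_or_ne t t₀ with rfl | hne
        · exact hc
        · exact hiso t (by rw [abs_lt]; constructor <;> linarith [ht.1, ht.2]) hne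
      have h4 : DifferentiableAt ℝ γ t₀ :=
        ((h.smooth _ _ (by linarith) h3).differentiableOn two_ne_zero).differentiableAt
          (Icc_mem_nhds hl hr)
      have h5 : u = v := by
        rw [eu, ev, h4.derivWithin (uniqueDiffWithinAt_Ici t₀),
          h4.derivWithin (uniqueDiffWithinAt_Iic t₀)]
      rw [← h5]
      intro h6
      exact hu0 (eq_zero_of_sameRay_self_neg h6)
  · intro r hrδ s hs t ht
    have hr0 : 0 ≤ r := by linarith [hs.1, hs.2]
    refine (hM₁ t₀ (t₀ + r) s t t₀ le_rfl (by linarith) hs ht ⟨le_rfl, by linarith⟩).trans ?_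
    rw [add_sub_cancel_left]
    gcongr
    exact le_max_left _ _
  · intro r hrδ s hs t ht
    have hr0 : 0 ≤ r := by linarith [hs.1, hs.2]
    refine (hM₂ (t₀ - r) t₀ s t t₀ (by linarith) le_rfl hs ht ⟨by linarith, le_rfl⟩).trans ?_
    rw [sub_sub_cancel]
    gcongr
    exact le_max_right _ _

theorem exists_le_norm_sub_local (h : IsPiecewiseC2Loop (C : Set Plane) γ) (t₀ : ℝ) :
    ∃ c > 0, ∃ δ > 0, ∀ s ∈ Ioo (t₀ - δ) (t₀ + δ), ∀ t ∈ Ioo (t₀ - δ) (t₀ + δ),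
      c * |s - t| ≤ ‖γ s - γ t‖ := by
  obtain ⟨u, v, hu, hv, huv, M, hM, δ, hδ, hR, hL⟩ := h.exists_one_sided t₀
  obtain ⟨c, hc, hcomb⟩ := exists_le_norm_combination hu hv huv
  obtain ⟨r, hr0, hrδ, hMr⟩ : ∃ r > 0, r ≤ δ ∧ M * r ≤ c / 2 := by
    refine ⟨min δ (c / (2 * (M + 1))), lt_min hδ (by positivity), min_le_left _ _, ?_⟩
    calc M * min δ (c / (2 * (M + 1))) ≤ M * (c / (2 * (M + 1))) := by
          gcongr; exact min_le_right _ _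
      _ ≤ (M + 1) * (c / (2 * (M + 1))) := by gcongr; linarith
      _ = c / 2 := by field_simp
  have key : ∀ s ∈ Ioo (t₀ - r) (t₀ + r), ∀ t ∈ Ioo (t₀ - r) (t₀ + r), s ≤ t →
      c / 2 * |t - s| ≤ ‖γ t - γ s‖ := by
    intro s hs t ht hst
    rw [abs_of_nonneg (sub_nonneg.2 hst)]
    obtain ⟨α, β, hα, hβ, hsum, hle⟩ : ∃ α β : ℝ, 0 ≤ α ∧ 0 ≤ β ∧ α + β = t - s ∧
        ‖γ t - γ s - (α • u + β • v)‖ ≤ c / 2 * (t - s) := by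
      rcases le_total t₀ s with h1 | h1
      · refine ⟨t - s, 0, by linarith, le_rfl, by ring, ?_⟩
        have := hR r hrδ s ⟨h1, hs.2.le⟩ t ⟨h1.trans hst, ht.2.le⟩
        rw [abs_of_nonneg (sub_nonneg.2 hst)] at this
        rw [zero_smul, add_zero]
        exact this.trans (mul_le_mul_of_nonneg_right hMr (by linarith))
      · rcases le_total t t₀ with h2 | h2
        · refine ⟨0, t - s, le_rfl, by linarith, by ring, ?_⟩
          have := hL r hrδ s ⟨hs.1.le, h1⟩ t ⟨ht.1.le, h2⟩
          rw [abs_of_nonneg (sub_nonneg.2 hst)] at this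
          rw [zero_smul, zero_add]
          exact this.trans (mul_le_mul_of_nonneg_right hMr (by linarith))
        · refine ⟨t - t₀, t₀ - s, by linarith, by linarith, by ring, ?_⟩
          have e1 := hR r hrδ t₀ ⟨le_rfl, by linarith⟩ t ⟨h2, ht.2.le⟩
          have e2 := hL r hrδ s ⟨hs.1.le, h1⟩ t₀ ⟨by linarith, le_rfl⟩
          rw [abs_of_nonneg (by linarith)] at e1 e2
          have e3 : γ t - γ s - ((t - t₀) • u + (t₀ - s) • v) =
              (γ t - γ t₀ - (t - t₀) • u) + (γ t₀ - γ s - (t₀ - s) • v) := by abel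
          rw [e3]
          refine (norm_add_le _ _).trans ?_
          calc _ ≤ M * r * (t - t₀) + M * r * (t₀ - s) := add_le_add e1 e2
            _ = M * r * (t - s) := by ring
            _ ≤ _ := mul_le_mul_of_nonneg_right hMr (by linarith)
    have h1 := hcomb α β hα hβ
    rw [hsum] at h1
    have h2 : ‖α • u + β • v‖ ≤ ‖γ t - γ s‖ + ‖γ t - γ s - (α • u + β • v)‖ := by
      have := norm_sub_le (γ t - γ s) (γ t - γ s - (α • u + β • v))
      rwa [sub_sub_cancel] at this
    linarith
  refine ⟨c / 2, by positivity, r, hr0, fun s hs t ht => ?_⟩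
  rcases le_total s t with h1 | h1
  · rw [abs_sub_comm, norm_sub_rev]
    exact key s hs t ht h1
  · exact key t ht s hs h1

/-- The chord-arc condition. -/
theorem exists_le_norm_sub (h : IsPiecewiseC2Loop (C : Set Plane) γ) :
    ∃ c > 0, ∀ s t, |s - t| ≤ 1 / 2 → c * |s - t| ≤ ‖γ s - γ t‖ := by
  have hK : IsCompact {x : ℝ × ℝ | x.1 ∈ Icc (0 : ℝ) 1 ∧ |x.1 - x.2| ≤ 1 / 2} := by
    refine ((isCompact_Icc (a := (0 : ℝ)) (b := 1)).prod (isCompact_Icc (a := (-1 : ℝ)) (b := 2))).of_isClosed_subset ?_ ?_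
    · exact (isClosed_Icc.preimage continuous_fst).inter
        (isClosed_le (f := fun x : ℝ × ℝ => |x.1 - x.2|) (by fun_prop) continuous_const)
    · rintro ⟨s, t⟩ ⟨h1, h2⟩
      rw [abs_le] at h2
      exact ⟨h1, by simp only at h1 h2 ⊢; constructor <;> linarith [h1.1, h1.2]⟩
  have key : ∃ c > 0, ∀ x ∈ {x : ℝ × ℝ | x.1 ∈ Icc (0 : ℝ) 1 ∧ |x.1 - x.2| ≤ 1 / 2},
      c * |x.1 - x.2| ≤ ‖γ x.1 - γ x.2‖ := by
    refine hK.induction_on (p := fun A : Set (ℝ × ℝ) => ∃ c > 0, ∀ x ∈ A,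
      c * |x.1 - x.2| ≤ ‖γ x.1 - γ x.2‖) ⟨1, one_pos, by simp⟩ ?_ ?_ ?_
    · rintro A B hAB ⟨c, hc, hB⟩
      exact ⟨c, hc, fun x hx => hB x (hAB hx)⟩
    · rintro A B ⟨c, hc, hA⟩ ⟨c', hc', hB⟩
      refine ⟨min c c', lt_min hc hc', ?_⟩
      rintro x (hx | hx)
      · refine le_trans ?_ (hA x hx)
        gcongr
        exact min_le_left _ _
      · refine le_trans ?_ (hB x hx)
        gcongr
        exact min_le_right _ _
    · rintro ⟨s, t⟩ ⟨-, hst⟩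
      simp only at hst
      rcases eq_or_ne s t with rfl | hne
      · obtain ⟨c, hc, δ, hδ, hloc⟩ := h.exists_le_norm_sub_local s
        have hn : Ioo (s - δ) (s + δ) ∈ 𝓝 s := Ioo_mem_nhds (by linarith) (by linarith)
        exact ⟨_, mem_nhdsWithin_of_mem_nhds (prod_mem_nhds hn hn), c, hc,
          fun x hx => hloc _ hx.1 _ hx.2⟩
      · have hd : 0 < ‖γ s - γ t‖ := by
          rw [norm_pos_iff, sub_ne_zero]
          exact fun he => hne (h.eq_of_abs_sub_lt_one he (by linarith))
        have hp : 0 < |s - t| := abs_pos.2 (sub_ne_zero.2 hne)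
        set c := ‖γ s - γ t‖ / (2 * |s - t|) with hc
        have hcpos : 0 < c := by positivity
        have hlt : c * |s - t| < ‖γ s - γ t‖ := by
          have : c * |s - t| = ‖γ s - γ t‖ / 2 := by rw [hc]; field_simp
          linarith
        have hcont : Continuous γ := h.continuous
        have hev : ∀ᶠ x : ℝ × ℝ in 𝓝 (s, t), c * |x.1 - x.2| < ‖γ x.1 - γ x.2‖ :=
          ContinuousAt.eventually_lt (by fun_prop) (by fun_prop) hlt
        exact ⟨_, mem_nhdsWithin_of_mem_nhds hev, c, hcpos, fun x hx => le_of_lt hx⟩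
  obtain ⟨c, hc, hkey⟩ := key
  refine ⟨c, hc, fun s t hst => ?_⟩
  have hshift : ∀ x, γ (x - ⌊s⌋) = γ x := fun x => by
    have := h.map_add_int x (-⌊s⌋)
    rwa [Int.cast_neg, ← sub_eq_add_neg] at this
  have := hkey (s - ⌊s⌋, t - ⌊s⌋) ⟨⟨Int.fract_nonneg s, (Int.fract_lt_one s).le⟩, by
    simpa only [sub_sub_sub_cancel_right] using hst⟩
  simpa only [hshift, sub_sub_sub_cancel_right] using this

end IsPiecewiseC2Loop

theorem subset_of_disjoint_frontier {X : Type*} [TopologicalSpace X] {A Ω : Set X}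
    (hA : IsPreconnected A) (hΩ : IsOpen Ω) (hd : Disjoint A (frontier Ω))
    (hne : (A ∩ Ω).Nonempty) : A ⊆ Ω := by
  refine hA.subset_of_closure_inter_subset hΩ hne fun x hx => ?_
  by_contra hxΩ
  refine disjoint_left.1 hd hx.2 ?_
  rw [hΩ.frontier_eq]
  exact ⟨hx.1, hxΩ⟩

/-- A set has locally two sides at `x` if its complement near `x` is covered by two connected sets
that do not meet it. -/
def TwoSidedAt (Γ : Set Plane) (x : Plane) : Prop :=
  ∃ W A B : Set Plane, IsOpen W ∧ x ∈ W ∧ IsPreconnected A ∧ IsPreconnected B ∧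
    Disjoint A Γ ∧ Disjoint B Γ ∧ W ⊆ A ∪ B ∪ Γ

theorem TwoSidedAt.mem_interior_union {Ω U : Set Plane} (hΩ : IsOpen Ω) (hU : IsOpen U)
    (hd : Disjoint Ω U) (hf : frontier U = frontier Ω) {x : Plane}
    (h : TwoSidedAt (frontier Ω) x) (hx : x ∈ frontier Ω) :
    x ∈ interior (Ω ∪ U ∪ frontier Ω) := by
  obtain ⟨W, A, B, hW, hxW, hA, hB, hAΓ, hBΓ, hsub⟩ := h
  have meets : ∀ O : Set Plane, IsOpen O → frontier O = frontier Ω →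
      (A ⊆ O ∧ (A ∩ O).Nonempty) ∨ (B ⊆ O ∧ (B ∩ O).Nonempty) := by
    intro O hO hOf
    rw [← hOf] at hx
    obtain ⟨y, hyW, hyO⟩ := mem_closure_iff.1 (frontier_subset_closure hx) W hW hxW
    rcases hsub hyW with (hy | hy) | hy
    · exact Or.inl ⟨subset_of_disjoint_frontier hA hO (hOf ▸ hAΓ) ⟨y, hy, hyO⟩, y, hy, hyO⟩
    · exact Or.inr ⟨subset_of_disjoint_frontier hB hO (hOf ▸ hBΓ) ⟨y, hy, hyO⟩, y, hy, hyO⟩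
    · rw [← hOf, hO.frontier_eq] at hy
      exact absurd hyO hy.2
  refine mem_interior.2 ⟨W, fun y hy => ?_, hW, hxW⟩
  have h1 := meets Ω hΩ rfl
  have h2 := meets U hU hf
  have hAB : A ∪ B ⊆ Ω ∪ U := by
    rcases h1 with ⟨h1, z, hz⟩ | ⟨h1, z, hz⟩ <;> rcases h2 with ⟨h2, -⟩ | ⟨h2, -⟩
    · exact absurd (h2 hz.1) (disjoint_left.1 hd hz.2)
    · exact union_subset_union h1 h2
    · rw [union_comm A]
      exact union_subset_union h1 h2
    · exact absurd (h2 hz.1) (disjoint_left.1 hd hz.2)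
  rcases hsub hy with hy | hy
  · exact Or.inl (hAB hy)
  · exact Or.inr hy

theorem eq_of_frontier_eq {Ω U : Set Plane} {C : Finset Plane} (hΩ : IsOpen Ω) (hU : IsOpen U)
    (hΩc : IsConnected Ω) (hUc : IsConnected U) (hΩb : Bornology.IsBounded Ω)
    (hUb : Bornology.IsBounded U) (hf : frontier U = frontier Ω)
    (hC : (C : Set Plane) ⊆ frontier Ω)
    (hts : ∀ x ∈ frontier Ω, x ∉ C → TwoSidedAt (frontier Ω) x) : U = Ω := by
  by_contra hne
  have hΩf : Disjoint Ω (frontier Ω) := by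
    rw [hΩ.frontier_eq]; exact disjoint_sdiff_right
  have hUf : Disjoint U (frontier U) := by
    rw [hU.frontier_eq]; exact disjoint_sdiff_right
  have hd : Disjoint Ω U := by
    rw [disjoint_iff_inter_eq_empty]
    by_contra hcon
    have hcon := nonempty_iff_ne_empty.2 hcon
    refine hne (Subset.antisymm ?_ ?_)
    · exact subset_of_disjoint_frontier hUc.isPreconnected hΩ (hf ▸ hUf) (inter_comm Ω U ▸ hcon)
    · exact subset_of_disjoint_frontier hΩc.isPreconnected hU (hf ▸ hΩf) hcon
  set S := Ω ∪ U ∪ frontier Ω with hS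
  have hScl : IsClosed S := by
    have : S = closure Ω ∪ closure U := by
      rw [closure_eq_self_union_frontier, closure_eq_self_union_frontier, hf, hS]
      ext; simp only [mem_union]; tauto
    rw [this]
    exact isClosed_closure.union isClosed_closure
  have hSb : Bornology.IsBounded (S ∪ C) := by
    refine ((hΩb.union hUb).union (hΩb.closure.subset frontier_subset_closure)).union ?_
    exact C.finite_toSet.isBounded
  obtain ⟨y, hy⟩ : ∃ y, y ∉ S ∪ C := by
    by_contra! hcon
    exact NormedSpace.unbounded_univ ℝ Plane (hSb.subset fun y _ => hcon y)
  have hpre : IsPreconnected (C : Set Plane)ᶜ :=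
    (C.finite_toSet.countable.isPathConnected_compl_of_one_lt_rank (by
      rw [← Module.finrank_eq_rank]; norm_num)).isConnected.isPreconnected
  have hsub : (C : Set Plane)ᶜ ⊆ interior S := by
    refine hpre.subset_left_of_subset_union isOpen_interior hScl.isOpen_compl
      (disjoint_compl_right.mono_left interior_subset) (fun x hx => ?_) ?_
    · by_cases hxS : x ∈ S
      · left
        rcases hxS with (hx1 | hx1) | hx1
        · exact mem_interior.2 ⟨Ω, fun z hz => Or.inl (Or.inl hz), hΩ, hx1⟩
        · exact mem_interior.2 ⟨U, fun z hz => Or.inl (Or.inr hz), hU, hx1⟩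
        · exact (hts x hx1 hx).mem_interior_union hΩ hU hd hf hx1
      · exact Or.inr hxS
    · obtain ⟨x, hx⟩ := hΩc.nonempty
      exact ⟨x, fun hxC => disjoint_left.1 hΩf hx (hC hxC),
        mem_interior.2 ⟨Ω, fun z hz => Or.inl (Or.inl hz), hΩ, hx⟩⟩
  exact hy (Or.inl (interior_subset (hsub fun hyC => hy (Or.inr hyC))))

theorem exists_abs_add_int_sub_le (s t : ℝ) : ∃ n : ℤ, |s + n - t| ≤ 1 / 2 := by
  refine ⟨-round (s - t), ?_⟩
  have e : s + ((-round (s - t) : ℤ) : ℝ) - t = s - t - round (s - t) := by push_cast; ring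
  rw [e]
  exact abs_sub_round (s - t)

/-- The linear isomorphism `(t, r) ↦ t u + r u^⊥`. -/
theorem exists_equiv_of_ne_zero {u : Plane} (hu : u ≠ 0) :
    ∃ (n : Plane) (L : (ℝ × ℝ) ≃L[ℝ] Plane), ∀ x, L x = x.1 • u + x.2 • n := by
  let n : Plane := !₂[-(u 1), u 0]
  let f : (ℝ × ℝ) →ₗ[ℝ] Plane :=
    (LinearMap.fst ℝ ℝ ℝ).smulRight u + (LinearMap.snd ℝ ℝ ℝ).smulRight n
  have hf : ∀ x, f x = x.1 • u + x.2 • n := fun x => rfl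
  have hpos : 0 < u 0 ^ 2 + u 1 ^ 2 := by
    by_contra hcon
    refine hu ?_
    ext i
    fin_cases i
    · simp only [Fin.zero_eta, PiLp.zero_apply]; nlinarith [sq_nonneg (u 0), sq_nonneg (u 1)]
    · simp only [Fin.mk_one, PiLp.zero_apply]; nlinarith [sq_nonneg (u 0), sq_nonneg (u 1)]
  have hinj : Function.Injective f := by
    rw [← LinearMap.ker_eq_bot, LinearMap.ker_eq_bot']
    intro x hx
    rw [hf] at hx
    have h0 : x.1 * u 0 - x.2 * u 1 = 0 := by
      have := congrArg (fun v : Plane => v 0) hx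
      simp [n] at this
      linarith
    have h1 : x.1 * u 1 + x.2 * u 0 = 0 := by
      have := congrArg (fun v : Plane => v 1) hx
      simpa [n] using this
    have e1 : x.1 * (u 0 ^ 2 + u 1 ^ 2) = 0 := by linear_combination u 0 * h0 + u 1 * h1
    have e2 : x.2 * (u 0 ^ 2 + u 1 ^ 2) = 0 := by linear_combination u 0 * h1 - u 1 * h0
    exact Prod.ext ((mul_eq_zero.1 e1).resolve_right hpos.ne')
      ((mul_eq_zero.1 e2).resolve_right hpos.ne')
  let e := LinearEquiv.ofInjectiveOfFinrankEq f hinj (by simp)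
  exact ⟨n, e.toContinuousLinearEquiv, hf⟩

theorem IsPiecewiseC2Loop.contDiffAt {C : Finset Plane} {γ : ℝ → Plane}
    (h : IsPiecewiseC2Loop (C : Set Plane) γ) {t₀ : ℝ} (ht₀ : γ t₀ ∉ (C : Set Plane)) :
    ContDiffAt ℝ 2 γ t₀ ∧ deriv γ t₀ ≠ 0 := by
  obtain ⟨δ, hδ, hiso⟩ := h.exists_isolated t₀
  have h3 : ∀ t ∈ Ioo (t₀ - δ) (t₀ + δ), γ t ∉ (C : Set Plane) := fun t ht => by
    rcases eq_or_ne t t₀ with rfl | hne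
    · exact ht₀
    · exact hiso t (by rw [abs_lt]; constructor <;> linarith [ht.1, ht.2]) hne
  have hn : Icc (t₀ - δ) (t₀ + δ) ∈ 𝓝 t₀ := Icc_mem_nhds (by linarith) (by linarith)
  have h4 := (h.smooth (t₀ - δ) (t₀ + δ) (by linarith) h3).contDiffAt hn
  refine ⟨h4, ?_⟩
  rw [← derivWithin_of_mem_nhds hn]
  exact h.regular _ _ (by linarith) h3 t₀ (mem_of_mem_nhds hn)

theorem IsPiecewiseC2Loop.twoSidedAt {C : Finset Plane} {γ : ℝ → Plane}
    (h : IsPiecewiseC2Loop (C : Set Plane) γ) {Γ' : Set Plane} (hΓ' : IsClosed Γ') {t₀ : ℝ}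
    (ht₀ : γ t₀ ∉ (C : Set Plane)) (ht₀' : γ t₀ ∉ Γ') : TwoSidedAt (range γ ∪ Γ') (γ t₀) := by
  obtain ⟨hsm, hreg⟩ := h.contDiffAt ht₀
  obtain ⟨n, L, hL⟩ := exists_equiv_of_ne_zero hreg
  obtain ⟨c, hc, hchord⟩ := h.exists_le_norm_sub
  let Φ : ℝ × ℝ → Plane := fun x => γ x.1 + x.2 • n
  have hΦc : Continuous Φ := by
    have := h.continuous
    fun_prop
  have hΦ : HasStrictFDerivAt Φ (L : ℝ × ℝ →L[ℝ] Plane) (t₀, 0) := by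
    have h1 : HasStrictFDerivAt (fun x : ℝ × ℝ => γ x.1) _ (t₀, 0) :=
      (hsm.hasStrictDerivAt two_ne_zero).hasStrictFDerivAt.comp (t₀, (0 : ℝ)) hasStrictFDerivAt_fst
    have h2 : HasStrictFDerivAt (fun x : ℝ × ℝ => x.2 • n) _ (t₀, 0) :=
      ((ContinuousLinearMap.snd ℝ ℝ ℝ).smulRight n).hasStrictFDerivAt
    refine (h1.add h2).congr_fderiv ?_
    ext <;> simp [hL]
  let e := hΦ.toOpenPartialHomeomorph Φ
  have he : ∀ x, e x = Φ x := fun x => rfl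
  have hsrc : e.source ∈ 𝓝 (t₀, (0 : ℝ)) :=
    e.open_source.mem_nhds hΦ.mem_toOpenPartialHomeomorph_source
  have box : ∀ S ∈ 𝓝 (t₀, (0 : ℝ)), ∃ δ > 0, Ioo (t₀ - δ) (t₀ + δ) ×ˢ Ioo (-δ) δ ⊆ S := by
    intro S hS
    obtain ⟨δ, hδ, hb⟩ := Metric.mem_nhds_iff.1 hS
    refine ⟨δ, hδ, fun x hx => hb ?_⟩
    rw [Metric.mem_ball, Prod.dist_eq, max_lt_iff, Real.dist_eq, Real.dist_eq, abs_lt, abs_lt]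
    obtain ⟨⟨h1, h2⟩, h3, h4⟩ := hx
    refine ⟨⟨?_, ?_⟩, ?_, ?_⟩ <;> simp only <;> linarith
  obtain ⟨δ₀, hδ₀, hbox₀⟩ := box _ hsrc
  obtain ⟨η, hη, hηΓ⟩ := Metric.isOpen_iff.1 hΓ'.isOpen_compl (γ t₀) ht₀'
  have hΦ0 : Φ (t₀, 0) = γ t₀ := by simp [Φ]
  obtain ⟨δ, hδ, hbox⟩ := box (e.source ∩ Φ ⁻¹' Metric.ball (γ t₀) (min η (c * δ₀)))
    (inter_mem hsrc (hΦc.continuousAt.preimage_mem_nhds (by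
      rw [hΦ0]; exact Metric.ball_mem_nhds _ (lt_min hη (by positivity)))))
  have hdisj : ∀ x ∈ Ioo (t₀ - δ) (t₀ + δ) ×ˢ Ioo (-δ) δ, Φ x ∈ range γ ∪ Γ' → x.2 = 0 := by
    intro x hx hmem
    obtain ⟨hxs, hxb⟩ := hbox hx
    rw [mem_preimage, Metric.mem_ball] at hxb
    rcases hmem with ⟨s, hs⟩ | hmem
    · obtain ⟨k, hk⟩ := exists_abs_add_int_sub_le s t₀
      rw [← h.map_add_int s k] at hs
      have h1 := hchord _ _ hk
      rw [hs, ← dist_eq_norm] at h1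
      have h2 : |s + k - t₀| < δ₀ := by
        have := h1.trans_lt (hxb.trans_le (min_le_right _ _))
        exact lt_of_mul_lt_mul_left this hc.le
      rw [abs_lt] at h2
      have h3 : (s + k, (0 : ℝ)) ∈ e.source :=
        hbox₀ ⟨⟨by linarith, by linarith⟩, by simpa using hδ₀⟩
      have h4 : e (s + k, 0) = e x := by
        rw [he, he, ← hs]; simp [Φ]
      have h5 := e.injOn h3 hxs h4
      rw [← h5]
    · exact absurd hmem (hηΓ (hxb.trans_le (min_le_left _ _)))
  have hpre : ∀ I : Set ℝ, Convex ℝ I → IsPreconnected (Φ '' (Ioo (t₀ - δ) (t₀ + δ) ×ˢ I)) :=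
    fun I hI => ((convex_Ioo _ _).prod hI).isPreconnected.image _ hΦc.continuousOn
  refine ⟨Φ '' (Ioo (t₀ - δ) (t₀ + δ) ×ˢ Ioo (-δ) δ), Φ '' (Ioo (t₀ - δ) (t₀ + δ) ×ˢ Ioo 0 δ),
    Φ '' (Ioo (t₀ - δ) (t₀ + δ) ×ˢ Ioo (-δ) 0), ?_, ?_, hpre _ (convex_Ioo _ _),
    hpre _ (convex_Ioo _ _), ?_, ?_, ?_⟩
  · exact e.isOpen_image_of_subset_source (isOpen_Ioo.prod isOpen_Ioo) fun x hx => (hbox hx).1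
  · exact ⟨(t₀, 0), ⟨⟨by linarith, by linarith⟩, by simpa using hδ⟩, hΦ0⟩
  · rw [disjoint_left]
    rintro _ ⟨x, hx, rfl⟩ hmem
    exact hx.2.1.ne' (hdisj x ⟨hx.1, by linarith [hx.2.1], hx.2.2⟩ hmem)
  · rw [disjoint_left]
    rintro _ ⟨x, hx, rfl⟩ hmem
    exact hx.2.2.ne (hdisj x ⟨hx.1, hx.2.1, by linarith [hx.2.2]⟩ hmem)
  · rintro _ ⟨x, hx, rfl⟩
    rcases lt_trichotomy x.2 0 with h1 | h1 | h1
    · exact Or.inl (Or.inr ⟨x, ⟨hx.1, hx.2.1, h1⟩, rfl⟩)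
    · exact Or.inr (Or.inl ⟨x.1, by simp [Φ, h1]⟩)
    · exact Or.inl (Or.inl ⟨x, ⟨hx.1, h1, hx.2.2⟩, rfl⟩)

theorem IsPiecewiseC2Loop.isCompact_range {C : Finset Plane} {γ : ℝ → Plane}
    (h : IsPiecewiseC2Loop (C : Set Plane) γ) : IsCompact (range γ) := by
  have : range γ = γ '' Icc 0 1 := by
    refine Subset.antisymm ?_ (image_subset_range _ _)
    rintro _ ⟨t, rfl⟩
    refine ⟨Int.fract t, ⟨Int.fract_nonneg t, (Int.fract_lt_one t).le⟩, ?_⟩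
    rw [← h.map_add_int (Int.fract t) ⌊t⌋, Int.fract_add_floor]
  rw [this]
  exact isCompact_Icc.image h.continuous

theorem IsBoundaryParam.twoSidedAt {Ω : Set Plane} {C : Finset Plane} {m : ℕ}
    {γ : Fin m → ℝ → Plane} (h : IsBoundaryParam Ω C γ) {x : Plane} (hx : x ∈ frontier Ω)
    (hxC : x ∉ C) : TwoSidedAt (frontier Ω) x := by
  have hx' := hx
  rw [h.frontier_eq, mem_iUnion] at hx'
  obtain ⟨i, t, rfl⟩ := hx'
  have hcl : IsClosed (⋃ k : {k // k ≠ i}, range (γ k)) :=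
    isClosed_iUnion_of_finite fun k => (h.loop k).isCompact_range.isClosed
  have e : frontier Ω = range (γ i) ∪ ⋃ k : {k // k ≠ i}, range (γ k) := by
    rw [h.frontier_eq]
    ext y
    simp only [mem_iUnion, mem_union, Subtype.exists, exists_prop]
    constructor
    · rintro ⟨k, hk⟩
      rcases eq_or_ne k i with rfl | hne
      · exact Or.inl hk
      · exact Or.inr ⟨k, hne, hk⟩
    · rintro (hk | ⟨k, -, hk⟩)
      exacts [⟨i, hk⟩, ⟨k, hk⟩]
  rw [e]
  refine (h.loop i).twoSidedAt hcl hxC ?_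
  simp only [mem_iUnion, Subtype.exists, not_exists]
  intro k hk hmem
  exact disjoint_left.1 (h.disjoint i k hk.symm) ⟨t, rfl⟩ hmem

/-- `τ` is a periodic sequence of parameters of nodes on the loop `γ`, as in a polygonal
`h`-approximation. -/
structure IsNodeSeq (C : Finset Plane) (h : ℝ) (γ : ℝ → Plane) (N : ℕ) (τ : ℤ → ℝ) : Prop where
  pos : 0 < N
  strictMono : StrictMono τ
  shift : ∀ j, τ (j + N) = τ j + 1
  corner : ∀ t, γ t ∈ (C : Set Plane) → ∃ j, t = τ j
  side : ∀ j, dist (γ (τ j)) (γ (τ (j + 1))) < h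
  arc : ((C : Set Plane) ∩ range γ).Subsingleton → ∀ j, ∀ t ∈ Icc (τ j) (τ (j + 1)),
    Metric.infDist (γ t) (segment ℝ (γ (τ j)) (γ (τ (j + 1)))) < h

/-- The closed polygonal line with nodes `γ (τ j)`. -/
def polyLine (γ : ℝ → Plane) (τ : ℤ → ℝ) : Set Plane :=
  ⋃ j, segment ℝ (γ (τ j)) (γ (τ (j + 1)))

theorem node_add_mul {τ : ℤ → ℝ} {N : ℕ} (h : ∀ j, τ (j + N) = τ j + 1) (j n : ℤ) :
    τ (j + n * N) = τ j + n := by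
  induction n using Int.induction_on with
  | zero => simp
  | succ i ih =>
    have := h (j + i * N)
    rw [ih] at this
    have e : j + ((i : ℤ) + 1) * N = j + i * N + N := by ring
    rw [e, this]
    push_cast
    ring
  | pred i ih =>
    have := h (j + (-i - 1) * N)
    have e : j + (-(i : ℤ) - 1) * N + N = j + -i * N := by ring
    rw [e, ih] at this
    push_cast at this ⊢
    linarith

theorem neg_add_one_add_one (j : ℤ) : -(j + 1) + 1 = -j := by ring

theorem IsNodeSeq.neg {C : Finset Plane} {h : ℝ} {γ : ℝ → Plane} {N : ℕ} {τ : ℤ → ℝ}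
    (hn : IsNodeSeq C h γ N τ) : IsNodeSeq C h (fun t => γ (-t)) N fun j => -τ (-j) where
  pos := hn.pos
  strictMono := fun i j hij => neg_lt_neg (hn.strictMono (neg_lt_neg hij))
  shift j := by
    have := hn.shift (-j - N)
    rw [sub_add_cancel] at this
    rw [neg_add, ← sub_eq_add_neg]
    linarith
  corner t ht := by
    obtain ⟨j, hj⟩ := hn.corner (-t) ht
    exact ⟨-j, by rw [neg_neg, ← hj, neg_neg]⟩
  side j := by
    have := hn.side (-(j + 1))
    rw [neg_add_one_add_one] at this
    simpa only [neg_neg, dist_comm] using this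
  arc hs j t ht := by
    have hr : range (fun t => γ (-t)) = range γ := (Equiv.neg ℝ).surjective.range_comp γ
    have := hn.arc (hr ▸ hs) (-(j + 1)) (-t) (by
      rw [neg_add_one_add_one]
      exact ⟨by linarith [ht.2], by linarith [ht.1]⟩)
    rw [neg_add_one_add_one, segment_symm] at this
    simpa only [neg_neg] using this

theorem polyLine_neg (γ : ℝ → Plane) (τ : ℤ → ℝ) :
    polyLine (fun t => γ (-t)) (fun j => -τ (-j)) = polyLine γ τ := by
  unfold polyLine
  simp only [neg_neg]
  refine Subset.antisymm (iUnion_subset fun j => ?_) (iUnion_subset fun j => ?_)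
  · refine subset_iUnion_of_subset (-(j + 1)) ?_
    rw [neg_add_one_add_one, segment_symm]
  · refine subset_iUnion_of_subset (-(j + 1)) ?_
    rw [neg_add_one_add_one, neg_neg, neg_neg, segment_symm]

namespace IsPiecewiseC2Loop

variable {C : Finset Plane} {γ γ₀ : ℝ → Plane}

/-- Two parametrizations of the same curve differ by a homeomorphism of the line. -/
theorem exists_reparam (h : IsPiecewiseC2Loop (C : Set Plane) γ)
    (h₀ : IsPiecewiseC2Loop (C : Set Plane) γ₀) (hr : range γ = range γ₀) :
    ∃ θ : ℝ → ℝ, Continuous θ ∧ (∀ t, γ₀ (θ t) = γ t) ∧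
      ((StrictMono θ ∧ ∀ t, θ (t + 1) = θ t + 1) ∨
        (StrictAnti θ ∧ ∀ t, θ (t + 1) = θ t - 1)) := by
  have : Fact ((0 : ℝ) < 1) := ⟨one_pos⟩
  let f₀ : AddCircle (1 : ℝ) → Plane := h₀.periodic.lift
  have hf₀ : ∀ t : ℝ, f₀ t = γ₀ t := fun t => h₀.periodic.lift_coe t
  have hf₀c : Continuous f₀ := by
    refine (QuotientAddGroup.isOpenQuotientMap_mk.isQuotientMap.continuous_iff).2 ?_
    exact h₀.continuous
  have hf₀i : Function.Injective f₀ := by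
    intro x y hxy
    induction x using QuotientAddGroup.induction_on with | _ s => ?_
    induction y using QuotientAddGroup.induction_on with | _ t => ?_
    obtain ⟨n, hn⟩ := h₀.eq_iff.1 ((hf₀ s).symm.trans (hxy.trans (hf₀ t)))
    change (s : AddCircle (1 : ℝ)) = (t : AddCircle (1 : ℝ))
    rw [hn, AddCircle.coe_add, (AddCircle.coe_eq_zero_iff (1 : ℝ) (x := (n : ℝ))).2 ⟨n, by simp⟩,
      add_zero]
  have hemb : IsEmbedding f₀ := (hf₀c.isClosedEmbedding hf₀i).isEmbedding
  have hex : ∀ t, ∃ x, f₀ x = γ t := fun t => by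
    obtain ⟨s, hs⟩ : γ t ∈ range γ₀ := hr ▸ mem_range_self t
    exact ⟨s, (hf₀ s).trans hs⟩
  choose g hg using hex
  have hgc : Continuous g := by
    rw [hemb.continuous_iff]
    exact (funext hg : f₀ ∘ g = γ) ▸ h.continuous
  obtain ⟨e₀, he₀⟩ := QuotientAddGroup.mk_surjective (g 0)
  obtain ⟨θ, ⟨-, hθ⟩, -⟩ := (AddCircle.isCoveringMap_coe (1 : ℝ)).existsUnique_continuousMap_lifts
    (⟨g, hgc⟩ : C(ℝ, AddCircle (1 : ℝ))) 0 e₀ he₀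
  have hθγ : ∀ t, γ₀ (θ t) = γ t := fun t => by
    rw [← hg t, ← hf₀]
    exact congrArg f₀ (congrFun hθ t)
  have hθc : Continuous θ := θ.continuous
  have hint : ∀ s t, θ s = θ t → ∃ n : ℤ, s = t + n := fun s t hst =>
    h.eq_iff.1 (by rw [← hθγ, ← hθγ, hst])
  obtain ⟨n, hn⟩ : ∃ n : ℤ, ∀ t, θ (t + 1) = θ t + n := by
    have : ∀ t, ∃ n : ℤ, θ (t + 1) = θ t + n := fun t =>
      h₀.eq_iff.1 (by rw [hθγ, hθγ, h.periodic])
    choose k hk using this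
    have hkc : Continuous k := by
      rw [Int.isClosedEmbedding_coe_real.isEmbedding.continuous_iff]
      have : (Int.cast ∘ k : ℝ → ℝ) = fun t => θ (t + 1) - θ t := by
        ext t; simp [hk]
      rw [this]
      fun_prop
    exact ⟨k 0, fun t => by rw [hk, PreconnectedSpace.constant inferInstance hkc (x := t) (y := 0)]⟩
  have hn1 : θ 1 = θ 0 + n := by simpa using hn 0
  have h01 : ∀ s ∈ Icc (0 : ℝ) 1, θ s = θ 0 + 1 ∨ θ s = θ 0 - 1 → θ s = θ 1 := by
    intro s hs hs'
    obtain ⟨k, hk⟩ : ∃ k : ℤ, θ s = θ 0 + k := by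
      rcases hs' with h1 | h1
      · exact ⟨1, by simp [h1]⟩
      · exact ⟨-1, by rw [h1]; push_cast; ring⟩
    obtain ⟨l, hl⟩ := h.eq_iff.1 ((hθγ s).symm.trans ((h₀.eq_iff.2 ⟨k, hk⟩).trans (hθγ 0)))
    rw [zero_add] at hl
    have h2 : (0 : ℤ) ≤ l := by exact_mod_cast hl ▸ hs.1
    have h3 : l ≤ (1 : ℤ) := by exact_mod_cast hl ▸ hs.2
    obtain rfl | rfl : l = 0 ∨ l = 1 := by omega
    · rw [Int.cast_zero] at hl
      rw [hl] at hs'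
      rcases hs' with h4 | h4 <;> linarith
    · rw [hl, Int.cast_one]
  have hn0 : n ≠ 0 := by
    rintro rfl
    rw [Int.cast_zero, add_zero] at hn1
    have hne : θ (1 / 2) ≠ θ 0 := fun he => by
      obtain ⟨k, hk⟩ := hint _ _ he
      have h2 : (2 * k : ℤ) = 1 := by
        have : (2 * k : ℝ) = 1 := by linarith
        exact_mod_cast this
      omega
    have hmid : (θ 0 + θ (1 / 2)) / 2 ∈ uIcc (θ 0) (θ (1 / 2)) := by
      rw [mem_uIcc]
      rcases le_total (θ 0) (θ (1 / 2)) with h1 | h1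
      · left; constructor <;> linarith
      · right; constructor <;> linarith
    obtain ⟨a, ha, hay⟩ := intermediate_value_uIcc hθc.continuousOn hmid
    rw [uIcc_comm, ← hn1] at hmid
    obtain ⟨b, hb, hby⟩ := intermediate_value_uIcc hθc.continuousOn hmid
    rw [uIcc_of_le (by norm_num)] at ha hb
    obtain ⟨k, hk⟩ := hint b a (by rw [hay, hby, hn1])
    have h2 : (0 : ℤ) ≤ k := by
      have : (0 : ℝ) ≤ k := by linarith [ha.2, hb.1]
      exact_mod_cast this
    have h3 : k ≤ (1 : ℤ) := by
      have : (k : ℝ) ≤ 1 := by linarith [ha.1, hb.2]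
      exact_mod_cast this
    obtain rfl | rfl : k = 0 ∨ k = 1 := by omega
    · rw [Int.cast_zero, add_zero] at hk
      have : a = 1 / 2 := le_antisymm ha.2 (hk ▸ hb.1)
      rw [this] at hay
      exact hne (by linarith)
    · rw [Int.cast_one] at hk
      have : a = 0 := le_antisymm (by linarith [hb.2]) ha.1
      rw [this] at hay
      exact hne (by linarith)
  have hpm : n = 1 ∨ n = -1 := by
    by_contra! hcon
    obtain h1 | h1 : 2 ≤ n ∨ n ≤ -2 := by omega
    · have h2 : (2 : ℝ) ≤ n := by exact_mod_cast h1
      obtain ⟨s, hs, hs'⟩ := intermediate_value_Icc zero_le_one hθc.continuousOn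
        (show θ 0 + 1 ∈ Icc (θ 0) (θ 1) from ⟨by linarith, by linarith⟩)
      linarith [h01 s hs (Or.inl hs')]
    · have h2 : (n : ℝ) ≤ -2 := by exact_mod_cast h1
      obtain ⟨s, hs, hs'⟩ := intermediate_value_Icc' zero_le_one hθc.continuousOn
        (show θ 0 - 1 ∈ Icc (θ 1) (θ 0) from ⟨by linarith, by linarith⟩)
      linarith [h01 s hs (Or.inr hs')]
  have hinj : Function.Injective θ := by
    intro s t hst
    obtain ⟨k, hk⟩ := hint s t hst
    have hper : Function.Periodic (fun t => θ t - n * t) 1 := fun t => by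
      simp only [hn]; ring
    have h1 : θ (t + k) - n * (t + k) = θ t - n * t := by simpa using hper.int_mul k t
    rw [← hk, hst, hk] at h1
    have h2 : (n : ℝ) * k = 0 := by linarith
    rcases mul_eq_zero.1 h2 with h3 | h3
    · exact absurd (by exact_mod_cast h3) hn0
    · rw [hk, h3, add_zero]
  refine ⟨θ, hθc, hθγ, ?_⟩
  rcases hθc.strictMono_of_inj hinj with hm | hm
  · left
    refine ⟨hm, fun t => ?_⟩
    have h1 := hm (zero_lt_one' ℝ)
    rcases hpm with rfl | rfl
    · simpa using hn t
    · push_cast at hn1; linarith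
  · right
    refine ⟨hm, fun t => ?_⟩
    have h1 := hm (zero_lt_one' ℝ)
    rcases hpm with rfl | rfl
    · push_cast at hn1; linarith
    · rw [hn]; push_cast; ring

theorem isNodeSeq_comp
    (h₀ : IsPiecewiseC2Loop (C : Set Plane) γ₀) (hr : range γ = range γ₀) {θ : ℝ → ℝ}
    (hθc : Continuous θ) (hθ : ∀ t, γ₀ (θ t) = γ t) (hm : StrictMono θ)
    (hs : ∀ t, θ (t + 1) = θ t + 1) {ε : ℝ} {N : ℕ} {τ : ℤ → ℝ} (hn : IsNodeSeq C ε γ N τ) :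
    IsNodeSeq C ε γ₀ N fun j => θ (τ j) where
  pos := hn.pos
  strictMono := hm.comp hn.strictMono
  shift j := by rw [hn.shift, hs]
  corner t ht := by
    obtain ⟨s, hs'⟩ : γ₀ t ∈ range γ := hr ▸ mem_range_self t
    obtain ⟨j, rfl⟩ := hn.corner s (hs' ▸ ht)
    rw [← hθ] at hs'
    obtain ⟨n, hn'⟩ := h₀.eq_iff.1 hs'.symm
    refine ⟨j + n * N, ?_⟩
    rw [hn']
    exact (node_add_mul (τ := fun j => θ (τ j)) (fun j => by rw [hn.shift, hs]) j n).symm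
  side j := by rw [hθ, hθ]; exact hn.side j
  arc hC j t ht := by
    obtain ⟨s, hs, rfl⟩ := intermediate_value_Icc (hn.strictMono (lt_add_one j)).le
      hθc.continuousOn ht
    rw [hθ, hθ, hθ]
    exact hn.arc (hr ▸ hC) j s hs

theorem exists_isNodeSeq (h : IsPiecewiseC2Loop (C : Set Plane) γ)
    (h₀ : IsPiecewiseC2Loop (C : Set Plane) γ₀) (hr : range γ = range γ₀)
    {ε : ℝ} {N : ℕ} {τ : ℤ → ℝ} (hn : IsNodeSeq C ε γ N τ) :
    ∃ τ₀, IsNodeSeq C ε γ₀ N τ₀ ∧ polyLine γ₀ τ₀ = polyLine γ τ := by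
  obtain ⟨θ, hθc, hθ, ⟨hm, hs⟩ | ⟨hm, hs⟩⟩ := h.exists_reparam h₀ hr
  · refine ⟨_, isNodeSeq_comp h₀ hr hθc hθ hm hs hn, ?_⟩
    simp only [polyLine, hθ]
  · have hr' : range (fun t => γ (-t)) = range γ₀ :=
      ((Equiv.neg ℝ).surjective.range_comp γ).trans hr
    refine ⟨_, isNodeSeq_comp h₀ hr' (θ := fun t => θ (-t)) (hθc.comp continuous_neg)
      (fun t => hθ (-t)) (fun s t hst => hm (neg_lt_neg hst)) (fun t => ?_) hn.neg, ?_⟩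
    · have := hs (-(t + 1))
      rw [neg_add, neg_add_cancel_right, ← neg_add] at this
      linarith
    · rw [← polyLine_neg γ τ]
      simp only [polyLine, hθ]

end IsPiecewiseC2Loop

namespace IsPiecewiseC2Loop

variable {C : Finset Plane} {γ : ℝ → Plane}

/-- The parameters of the corners are uniformly separated. -/
theorem exists_corner_separation (h : IsPiecewiseC2Loop (C : Set Plane) γ) :
    ∃ δ > 0, ∀ s t, γ s ∈ (C : Set Plane) → γ t ∈ (C : Set Plane) → |s - t| < δ → s = t := by
  have key : ∃ δ > 0, ∀ s ∈ Icc (0 : ℝ) 1, ∀ t, γ s ∈ (C : Set Plane) → γ t ∈ (C : Set Plane) →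
      |s - t| < δ → s = t := by
    refine isCompact_Icc.induction_on (p := fun A : Set ℝ => ∃ δ > (0 : ℝ), ∀ s ∈ A, ∀ t,
      γ s ∈ (C : Set Plane) → γ t ∈ (C : Set Plane) → |s - t| < δ → s = t)
      ⟨1, one_pos, by simp⟩ ?_ ?_ ?_
    · rintro A B hAB ⟨δ, hδ, hB⟩
      exact ⟨δ, hδ, fun s hs => hB s (hAB hs)⟩
    · rintro A B ⟨δ, hδ, hA⟩ ⟨δ', hδ', hB⟩
      refine ⟨min δ δ', lt_min hδ hδ', ?_⟩
      rintro s (hs | hs) t h1 h2 hst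
      · exact hA s hs t h1 h2 (hst.trans_le (min_le_left _ _))
      · exact hB s hs t h1 h2 (hst.trans_le (min_le_right _ _))
    · intro t₀ _
      obtain ⟨δ, hδ, hiso⟩ := h.exists_isolated t₀
      refine ⟨Metric.ball t₀ (δ / 2), mem_nhdsWithin_of_mem_nhds
        (Metric.ball_mem_nhds _ (by positivity)), δ / 2, by positivity, ?_⟩
      intro s hs t h1 h2 hst
      rw [Metric.mem_ball, Real.dist_eq] at hs
      have hs0 : s = t₀ := by
        by_contra hne
        exact hiso s (by linarith) hne h1
      have ht0 : t = t₀ := by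
        by_contra hne
        exact hiso t (by rw [hs0, abs_sub_comm] at hst; linarith) hne h2
      rw [hs0, ht0]
  obtain ⟨δ, hδ, hkey⟩ := key
  have hshift : ∀ (s x : ℝ), γ (x - ⌊s⌋) = γ x := fun s x => by
    have := h.map_add_int x (-⌊s⌋)
    rwa [Int.cast_neg, ← sub_eq_add_neg] at this
  refine ⟨δ, hδ, fun s t h1 h2 hst => ?_⟩
  have := hkey (s - ⌊s⌋) ⟨Int.fract_nonneg s, (Int.fract_lt_one s).le⟩ (t - ⌊s⌋)
    (by rwa [hshift]) (by rwa [hshift]) (by rwa [sub_sub_sub_cancel_right])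
  linarith

end IsPiecewiseC2Loop

namespace IsNodeSeq

variable {C : Finset Plane} {h : ℝ} {γ : ℝ → Plane} {N : ℕ} {τ : ℤ → ℝ}

theorem gap_pos (hn : IsNodeSeq C h γ N τ) (j : ℤ) : 0 < τ (j + 1) - τ j :=
  sub_pos.2 (hn.strictMono (lt_add_one j))

theorem gap_le_one (hn : IsNodeSeq C h γ N τ) (j : ℤ) : τ (j + 1) - τ j ≤ 1 := by
  have h1 : τ (j + 1) ≤ τ (j + N) := hn.strictMono.monotone (by have := hn.pos; omega)
  rw [hn.shift] at h1
  linarith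

theorem notMem_of_mem_Ioo (hn : IsNodeSeq C h γ N τ) {j : ℤ} {t : ℝ}
    (ht : t ∈ Ioo (τ j) (τ (j + 1))) : γ t ∉ (C : Set Plane) := by
  intro hC
  obtain ⟨k, rfl⟩ := hn.corner t hC
  have h1 := hn.strictMono.lt_iff_lt.1 ht.1
  have h2 := hn.strictMono.lt_iff_lt.1 ht.2
  omega

theorem exists_cell (hn : IsNodeSeq C h γ N τ) (t : ℝ) :
    ∃ j, t ∈ Ico (τ j) (τ (j + 1)) := by
  have hb : ∃ b, ∀ j, τ j ≤ t → j ≤ b := by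
    refine ⟨0 + ⌈t - τ 0⌉ * N, fun j hj => ?_⟩
    by_contra! hlt
    have h1 := hn.strictMono hlt
    rw [node_add_mul hn.shift] at h1
    linarith [Int.le_ceil (t - τ 0)]
  have hne : ∃ j, τ j ≤ t := by
    refine ⟨0 + ⌊t - τ 0⌋ * N, ?_⟩
    rw [node_add_mul hn.shift]
    linarith [Int.floor_le (t - τ 0)]
  obtain ⟨j, hj, hmax⟩ := Int.exists_greatest_of_bdd hb hne
  refine ⟨j, hj, ?_⟩
  by_contra! hlt
  have := hmax _ hlt
  omega

theorem cell_unique (hn : IsNodeSeq C h γ N τ) {t : ℝ} {i j : ℤ}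
    (hi : t ∈ Ico (τ i) (τ (i + 1))) (hj : t ∈ Ico (τ j) (τ (j + 1))) : i = j := by
  have h1 := hn.strictMono.lt_iff_lt.1 (hi.1.trans_lt hj.2)
  have h2 := hn.strictMono.lt_iff_lt.1 (hj.1.trans_lt hi.2)
  omega

/-- The error of piecewise linear interpolation of `γ` at the nodes. -/
theorem exists_interpolation_error (hn : IsNodeSeq C h γ N τ) : ∃ e : ℝ → Plane,
    ∀ j, ∀ t ∈ Icc (τ j) (τ (j + 1)), γ t + e t =
      γ (τ j) + ((t - τ j) / (τ (j + 1) - τ j)) • (γ (τ (j + 1)) - γ (τ j)) := by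
  choose cell hcell using hn.exists_cell
  refine ⟨fun t => γ (τ (cell t)) + ((t - τ (cell t)) / (τ (cell t + 1) - τ (cell t))) •
    (γ (τ (cell t + 1)) - γ (τ (cell t))) - γ t, fun j t ht => ?_⟩
  rw [add_sub_cancel]
  rcases ht.2.eq_or_lt with h1 | h1
  · have : cell t = j + 1 := hn.cell_unique (hcell t)
      ⟨h1.ge, by rw [h1]; exact hn.strictMono (lt_add_one _)⟩
    rw [this, h1, sub_self, zero_div, zero_smul, add_zero, div_self (hn.gap_pos j).ne', one_smul,
      add_sub_cancel]
  · rw [hn.cell_unique (hcell t) ⟨ht.1, h1⟩]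

end IsNodeSeq

namespace IsPiecewiseC2Loop

variable {C : Finset Plane} {γ : ℝ → Plane}

theorem exists_gap_le (hγ : IsPiecewiseC2Loop (C : Set Plane) γ) {c : ℝ} (hc : 0 < c)
    (hchord : ∀ s t, |s - t| ≤ 1 / 2 → c * |s - t| ≤ ‖γ s - γ t‖) :
    ∃ h₀ > 0, ∀ h < h₀, ∀ N τ, IsNodeSeq C h γ N τ → ∀ j, τ (j + 1) - τ j ≤ h / c := by
  obtain ⟨δ, hδ, hsep⟩ := hγ.exists_corner_separation
  refine ⟨min (c * δ) (c / 4), lt_min (by positivity) (by positivity), fun h hh N τ hn j => ?_⟩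
  have hh1 : h < c * δ := hh.trans_le (min_le_left _ _)
  have hh2 : h < c / 4 := hh.trans_le (min_le_right _ _)
  set a := τ j with ha
  set b := τ (j + 1) with hb
  have hab : 0 < b - a := hn.gap_pos j
  have hab1 : b - a ≤ 1 := hn.gap_le_one j
  have hside : ‖γ a - γ b‖ < h := by
    rw [← dist_eq_norm]; exact hn.side j
  rcases le_or_gt (b - a) (1 / 2) with hle | hgt
  · have := hchord a b (by rw [abs_sub_comm, abs_of_pos hab]; exact hle)
    rw [abs_sub_comm, abs_of_pos hab] at this
    rw [le_div_iff₀ hc]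
    linarith
  exfalso
  have hshort : c * (a + 1 - b) < h := by
    have := hchord (a + 1) b (by rw [abs_of_nonneg (by linarith)]; linarith)
    rw [abs_of_nonneg (by linarith), hγ.periodic] at this
    linarith
  by_cases hs : ((C : Set Plane) ∩ range γ).Subsingleton
  · have h1 := hn.arc hs j (a + 1 / 2) ⟨by linarith, by linarith⟩
    rw [Metric.infDist_lt_iff ⟨_, left_mem_segment ℝ _ _⟩] at h1
    obtain ⟨y, hy, hdist⟩ := h1
    have h2 : dist y (γ a) ≤ h := by
      have h3 := (convex_closedBall (γ a) h).segment_subset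
        (Metric.mem_closedBall_self ((norm_nonneg _).trans hside.le))
        (show γ b ∈ Metric.closedBall (γ a) h by
          rw [Metric.mem_closedBall, dist_comm, dist_eq_norm]; exact hside.le) hy
      exact h3
    have h4 := hchord (a + 1 / 2) a (by rw [add_sub_cancel_left, abs_of_nonneg (by norm_num)])
    rw [add_sub_cancel_left, abs_of_nonneg (by norm_num), ← dist_eq_norm] at h4
    have := dist_triangle (γ (a + 1 / 2)) y (γ a)
    linarith
  · have hmem : ∀ p ∈ (C : Set Plane) ∩ range γ, ∃ s ∈ Icc b (a + 1), γ s = p := by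
      rintro _ ⟨hp, t, rfl⟩
      obtain ⟨k, hk, -⟩ := existsUnique_add_zsmul_mem_Ioc one_pos t a
      have e : γ (t + k • (1 : ℝ)) = γ t := by
        simpa using hγ.map_add_int t k
      refine ⟨_, ⟨?_, hk.2⟩, e⟩
      by_contra! hlt
      exact hn.notMem_of_mem_Ioo ⟨hk.1, hlt⟩ (e.symm ▸ hp)
    refine hs fun p hp p' hp' => ?_
    obtain ⟨s, hs1, rfl⟩ := hmem p hp
    obtain ⟨s', hs2, rfl⟩ := hmem p' hp'
    have h5 : a + 1 - b < δ := by
      by_contra! hcon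
      have := mul_le_mul_of_nonneg_left hcon hc.le
      linarith
    rw [hsep s s' hp.1 hp'.1 (by rw [abs_lt]; constructor <;> linarith [hs1.1, hs1.2, hs2.1, hs2.2])]

/-- The displacement from a loop to its polygonal interpolation is Lipschitz with constant `O(h)`
along the curve. -/
theorem exists_displacement (hγ : IsPiecewiseC2Loop (C : Set Plane) γ) :
    ∃ A ≥ 0, ∃ h₀ > 0, ∀ h < h₀, ∀ N τ, IsNodeSeq C h γ N τ → ∃ e : ℝ → Plane,
      (∀ s t, ‖e s - e t‖ ≤ A * h * ‖γ s - γ t‖) ∧ (∀ t, ‖e t‖ ≤ A * h) ∧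
      range (fun t => γ t + e t) = polyLine γ τ := by
  obtain ⟨c, hc, hchord⟩ := hγ.exists_le_norm_sub
  obtain ⟨h₀, hh₀, hgap⟩ := hγ.exists_gap_le hc hchord
  obtain ⟨M, hM, δ, hδ, harc⟩ := hγ.exists_arc_chord
  refine ⟨M / c * max 1 (1 / c), by positivity, min h₀ (c * δ), lt_min hh₀ (by positivity),
    fun h hh N τ hn => ?_⟩
  have hgap := hgap h (hh.trans_le (min_le_left _ _)) N τ hn
  have hhpos : 0 < h := dist_nonneg.trans_lt (hn.side 0)
  have hhδ : h / c < δ := by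
    rw [div_lt_iff₀ hc, mul_comm]
    exact hh.trans_le (min_le_right _ _)
  obtain ⟨e, he⟩ := hn.exists_interpolation_error
  set K := M * (h / c) with hK
  have hK0 : 0 ≤ K := by positivity
  have hcell : ∀ j, ∀ s ∈ Icc (τ j) (τ (j + 1)), ∀ t ∈ Icc (τ j) (τ (j + 1)),
      ‖e s - e t‖ ≤ K * |s - t| := by
    intro j s hs t ht
    have hpos := hn.gap_pos j
    have h1 := harc (τ j) (τ (j + 1)) (sub_pos.1 hpos) ((hgap j).trans_lt hhδ)
      (fun t ht => hn.notMem_of_mem_Ioo ht) s hs t ht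
    have h2 : e s - e t = γ t - γ s - ((t - s) / (τ (j + 1) - τ j)) •
        (γ (τ (j + 1)) - γ (τ j)) := by
      rw [eq_sub_of_add_eq' (he j s hs), eq_sub_of_add_eq' (he j t ht)]
      have h3 : (t - s) / (τ (j + 1) - τ j) =
          (t - τ j) / (τ (j + 1) - τ j) - (s - τ j) / (τ (j + 1) - τ j) := by ring
      rw [h3, sub_smul]
      abel
    rw [h2, abs_sub_comm s t]
    exact h1.trans (mul_le_mul_of_nonneg_right (mul_le_mul_of_nonneg_left (hgap j) hM)
      (abs_nonneg _))
  have hnode : ∀ j, e (τ j) = 0 := fun j => by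
    have := he j (τ j) ⟨le_rfl, (sub_pos.1 (hn.gap_pos j)).le⟩
    rw [sub_self, zero_div, zero_smul] at this
    exact add_left_cancel this
  have hmono : ∀ s t, s ≤ t → ‖e s - e t‖ ≤ K * |s - t| := by
    intro s t hst
    obtain ⟨i, hi⟩ := hn.exists_cell s
    obtain ⟨j, hj⟩ := hn.exists_cell t
    rcases lt_trichotomy i j with hij | rfl | hij
    · have h1 := hcell i s ⟨hi.1, hi.2.le⟩ (τ (i + 1)) ⟨hi.1.trans hi.2.le, le_rfl⟩
      have h2 := hcell j (τ j) ⟨le_rfl, hj.1.trans hj.2.le⟩ t ⟨hj.1, hj.2.le⟩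
      rw [hnode, sub_zero] at h1
      rw [hnode, zero_sub, norm_neg] at h2
      have h3 : τ (i + 1) ≤ τ j := hn.strictMono.monotone hij
      have h4 := hi.2.le
      have h5 := hj.1
      rw [abs_sub_comm, abs_of_nonneg (by linarith)] at h1 h2 ⊢
      calc ‖e s - e t‖ ≤ ‖e s‖ + ‖e t‖ := norm_sub_le _ _
        _ ≤ K * (τ (i + 1) - s) + K * (t - τ j) := add_le_add h1 h2
        _ = K * (τ (i + 1) - s + (t - τ j)) := by ring
        _ ≤ K * (t - s) := by gcongr; linarith
    · exact hcell i s ⟨hi.1, hi.2.le⟩ t ⟨hj.1, hj.2.le⟩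
    · have h1 := hn.strictMono.lt_iff_lt.1 (hi.1.trans_lt (hst.trans_lt hj.2))
      omega
  have hlip : ∀ s t, ‖e s - e t‖ ≤ K * |s - t| := by
    intro s t
    rcases le_total s t with hst | hst
    · exact hmono s t hst
    · rw [norm_sub_rev, abs_sub_comm]
      exact hmono t s hst
  have hper : Function.Periodic e 1 := by
    intro t
    obtain ⟨j, hj⟩ := hn.exists_cell t
    have e1 : τ (j + N + 1) = τ (j + 1) + 1 := by
      rw [← hn.shift (j + 1)]; congr 1; ring
    have h1 := he j t ⟨hj.1, hj.2.le⟩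
    have h2 := he (j + N) (t + 1) ⟨by rw [hn.shift]; linarith [hj.1],
      by rw [e1]; linarith [hj.2]⟩
    rw [e1, hn.shift, hγ.periodic, hγ.periodic, hγ.periodic, add_sub_add_right_eq_sub,
      add_sub_add_right_eq_sub, ← h1] at h2
    exact add_left_cancel h2
  have hKA : K ≤ M / c * max 1 (1 / c) * h := by
    calc K = M / c * 1 * h := by rw [hK]; ring
      _ ≤ _ := by gcongr; exact le_max_left _ _
  have hKA' : K / c ≤ M / c * max 1 (1 / c) * h := by
    calc K / c = M / c * (1 / c) * h := by rw [hK]; ring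
      _ ≤ _ := by gcongr; exact le_max_right _ _
  refine ⟨e, fun s t => ?_, fun t => ?_, Subset.antisymm ?_ ?_⟩
  · obtain ⟨n, hns⟩ := exists_abs_add_int_sub_le s t
    have h1 : e (s + n) = e s := by simpa using hper.int_mul n s
    have h2 := hlip (s + n) t
    have h3 := hchord (s + n) t hns
    rw [h1] at h2
    rw [hγ.map_add_int] at h3
    calc ‖e s - e t‖ ≤ K * |s + n - t| := h2
      _ = K / c * (c * |s + n - t|) := by field_simp
      _ ≤ K / c * ‖γ s - γ t‖ := by gcongr
      _ ≤ _ := by gcongr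
  · obtain ⟨j, hj⟩ := hn.exists_cell t
    have h1 := hlip t (τ j)
    rw [hnode, sub_zero, abs_of_nonneg (sub_nonneg.2 hj.1)] at h1
    refine h1.trans (le_trans ?_ hKA)
    exact mul_le_of_le_one_right hK0 (by linarith [hn.gap_le_one j, hj.2])
  · rintro _ ⟨t, rfl⟩
    obtain ⟨j, hj⟩ := hn.exists_cell t
    have hpos := hn.gap_pos j
    refine mem_iUnion.2 ⟨j, ?_⟩
    rw [segment_eq_image']
    refine ⟨(t - τ j) / (τ (j + 1) - τ j), ⟨div_nonneg (sub_nonneg.2 hj.1) hpos.le,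
      (div_le_one hpos).2 (by linarith [hj.2])⟩, (he j t ⟨hj.1, hj.2.le⟩).symm⟩
  · refine iUnion_subset fun j => ?_
    rw [segment_eq_image']
    rintro _ ⟨θ, hθ, rfl⟩
    have hpos := hn.gap_pos j
    have hmul : θ * (τ (j + 1) - τ j) ≤ τ (j + 1) - τ j := mul_le_of_le_one_left hpos.le hθ.2
    have h0 : 0 ≤ θ * (τ (j + 1) - τ j) := mul_nonneg hθ.1 hpos.le
    refine ⟨τ j + θ * (τ (j + 1) - τ j), ?_⟩
    simp only
    rw [he j _ ⟨by linarith, by linarith⟩, add_sub_cancel_left, mul_div_cancel_right₀ _ hpos.ne']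

end IsPiecewiseC2Loop

/-! ### Passing to a fixed parametrization of the boundary -/

theorem IsBoundaryParam.exists_range_eq {Ω : Set Plane} {C : Finset Plane} {m m' : ℕ}
    {γ : Fin m → ℝ → Plane} {γ' : Fin m' → ℝ → Plane} (h : IsBoundaryParam Ω C γ)
    (h' : IsBoundaryParam Ω C γ') (i : Fin m) : ∃ k, range (γ' k) = range (γ i) := by
  have sub : ∀ {m m' : ℕ} {γ : Fin m → ℝ → Plane} {γ' : Fin m' → ℝ → Plane}
      (_ : IsBoundaryParam Ω C γ) (_ : IsBoundaryParam Ω C γ') (i : Fin m) (k : Fin m'),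
      (range (γ i) ∩ range (γ' k)).Nonempty → range (γ i) ⊆ range (γ' k) := by
    intro m m' γ γ' h h' i k hne
    have hpre : IsPreconnected (range (γ i)) := isPreconnected_range (h.loop i).continuous
    have hcl : IsClosed (⋃ l : {l // l ≠ k}, range (γ' l)) :=
      isClosed_iUnion_of_finite fun l => (h'.loop l).isCompact_range.isClosed
    have hsub : range (γ i) ⊆ range (γ' k) ∪ ⋃ l : {l // l ≠ k}, range (γ' l) := by
      intro y hy
      have h1 : y ∈ frontier Ω := h.frontier_eq ▸ mem_iUnion.2 ⟨i, hy⟩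
      rw [h'.frontier_eq, mem_iUnion] at h1
      obtain ⟨l, hl⟩ := h1
      rcases eq_or_ne l k with rfl | hne
      · exact Or.inl hl
      · exact Or.inr (mem_iUnion.2 ⟨⟨l, hne⟩, hl⟩)
    have hdisj : range (γ' k) ∩ ⋃ l : {l // l ≠ k}, range (γ' l) = ∅ := by
      rw [← disjoint_iff_inter_eq_empty, disjoint_iUnion_right]
      exact fun l => h'.disjoint k l l.2.symm
    rcases isPreconnected_iff_subset_of_disjoint_closed.1 hpre _ _
      (h'.loop k).isCompact_range.isClosed hcl hsub (by rw [hdisj, inter_empty]) with h1 | h1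
    · exact h1
    · obtain ⟨y, hy, hyk⟩ := hne
      exact absurd ⟨hyk, h1 hy⟩ (eq_empty_iff_forall_notMem.1 hdisj y)
  have h0 : γ i 0 ∈ frontier Ω := h.frontier_eq ▸ mem_iUnion.2 ⟨i, mem_range_self 0⟩
  rw [h'.frontier_eq, mem_iUnion] at h0
  obtain ⟨k, hk⟩ := h0
  exact ⟨k, Subset.antisymm (sub h' h k i ⟨_, hk, mem_range_self 0⟩)
    (sub h h' i k ⟨_, mem_range_self 0, hk⟩)⟩

/-- A polygonal approximation interpolates any given parametrization of the boundary. -/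
theorem IsPolygonalApproximation.exists_isNodeSeq {Ω P : Set Plane} {C : Finset Plane} {h : ℝ}
    (hP : IsPolygonalApproximation Ω C h P) {m : ℕ} {γ : Fin m → ℝ → Plane}
    (hγ : IsBoundaryParam Ω C γ) :
    IsOpen P ∧ IsConnected P ∧ Bornology.IsBounded P ∧
    ∃ (N : Fin m → ℕ) (τ : Fin m → ℤ → ℝ), (∀ k, IsNodeSeq C h (γ k) (N k) (τ k)) ∧
      frontier P = ⋃ k, polyLine (γ k) (τ k) := by
  obtain ⟨m', γ', N', τ', hγ', hmono, hshift, hpoly, hcorner, hside, harc⟩ := hP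
  refine ⟨hpoly.isOpen, hpoly.isConnected, hpoly.isBounded, ?_⟩
  have hnode : ∀ i, IsNodeSeq C h (γ' i) (N' i) (τ' i) := fun i =>
    { pos := by have := hpoly.three_le i; omega
      strictMono := hmono i
      shift := hshift i
      corner := by
        intro t ht
        obtain ⟨i', j, hj⟩ := hcorner _ ht
        obtain rfl : i' = i := by
          by_contra hne
          exact disjoint_left.1 (hγ'.disjoint i' i hne) ⟨_, hj⟩ ⟨t, rfl⟩
        obtain ⟨n, hn⟩ := (hγ'.loop i').eq_iff.1 hj.symm
        exact ⟨j + n * N' i', by rw [node_add_mul (hshift i'), hn]⟩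
      side := hside i
      arc := harc i }
  choose σ hσ using fun k => hγ.exists_range_eq hγ' k
  have hex : ∀ k, ∃ τ₀, IsNodeSeq C h (γ k) (N' (σ k)) τ₀ ∧
      polyLine (γ k) τ₀ = polyLine (γ' (σ k)) (τ' (σ k)) := fun k =>
    (hγ'.loop (σ k)).exists_isNodeSeq (hγ.loop k) (hσ k) (hnode (σ k))
  choose τ hτ hline using hex
  refine ⟨_, τ, hτ, ?_⟩
  rw [hpoly.frontier_eq]
  refine Subset.antisymm (iUnion_subset fun i => ?_) (iUnion_subset fun k => ?_)
  · obtain ⟨k, hk⟩ := hγ'.exists_range_eq hγ i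
    have : σ k = i := by
      by_contra hne
      have h1 := hγ'.disjoint _ _ hne
      rw [hσ k, hk] at h1
      exact disjoint_left.1 h1 (mem_range_self 0) (mem_range_self 0)
    refine subset_iUnion_of_subset k ?_
    rw [hline, this]
    exact Subset.rfl
  · rw [hline]
    exact subset_iUnion (fun i => ⋃ j, segment ℝ (γ' i (τ' i j)) (γ' i (τ' i (j + 1)))) (σ k)

/-! ### The displacement field -/

theorem exists_pos_forall_le {ι : Type*} [Finite ι] {f : ι → ℝ} (hf : ∀ i, 0 < f i) :
    ∃ c > 0, ∀ i, c ≤ f i := by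
  cases isEmpty_or_nonempty ι
  · exact ⟨1, one_pos, fun i => isEmptyElim i⟩
  · obtain ⟨i, hi⟩ := Finite.exists_min f
    exact ⟨f i, hf i, hi⟩

theorem exists_nonneg_forall_le {ι : Type*} [Finite ι] (f : ι → ℝ) :
    ∃ A ≥ 0, ∀ i, f i ≤ A := by
  cases isEmpty_or_nonempty ι
  · exact ⟨0, le_rfl, fun i => isEmptyElim i⟩
  · obtain ⟨i, hi⟩ := Finite.exists_max f
    exact ⟨max 0 (f i), le_max_left _ _, fun j => (hi j).trans (le_max_right _ _)⟩

theorem IsBoundaryParam.exists_separation {Ω : Set Plane} {C : Finset Plane} {m : ℕ}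
    {γ : Fin m → ℝ → Plane} (h : IsBoundaryParam Ω C γ) :
    ∃ d > 0, ∀ i k, i ≠ k → ∀ s t, d ≤ ‖γ i s - γ k t‖ := by
  have hpair : ∀ x : {x : Fin m × Fin m // x.1 ≠ x.2}, ∃ d > 0, ∀ s t,
      d ≤ ‖γ x.1.1 s - γ x.1.2 t‖ := by
    rintro ⟨⟨i, k⟩, hne⟩
    obtain ⟨r, hr, hdist⟩ := Metric.exists_pos_forall_lt_edist (h.loop i).isCompact_range
      (h.loop k).isCompact_range.isClosed (h.disjoint i k hne)
    refine ⟨r, hr, fun s t => ?_⟩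
    have := hdist _ (mem_range_self s) _ (mem_range_self t)
    rw [edist_nndist, ENNReal.coe_lt_coe] at this
    rw [← dist_eq_norm, ← coe_nndist]
    exact_mod_cast this.le
  choose f hf hle using hpair
  obtain ⟨d, hd, hdf⟩ := exists_pos_forall_le hf
  exact ⟨d, hd, fun i k hne s t => (hdf ⟨(i, k), hne⟩).trans (hle ⟨(i, k), hne⟩ s t)⟩

/-- A field on the plane that moves the boundary to the polygonal lines, with a Lipschitz constant
`O(h)`. -/
theorem IsBoundaryParam.exists_displacement {Ω : Set Plane} {C : Finset Plane} {m : ℕ}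
    {γ : Fin m → ℝ → Plane} (hγ : IsBoundaryParam Ω C γ) :
    ∃ A ≥ 0, ∃ h₀ > 0, ∀ h, 0 < h → h < h₀ → ∀ (N : Fin m → ℕ) (τ : Fin m → ℤ → ℝ),
      (∀ k, IsNodeSeq C h (γ k) (N k) (τ k)) → ∃ w : Plane → Plane,
        LipschitzWith (Real.toNNReal (A * h)) w ∧
        (fun x => x + w x) '' frontier Ω = ⋃ k, polyLine (γ k) (τ k) := by
  choose A₁ hA₁ h₁ hh₁ hdisp using fun k => (hγ.loop k).exists_displacement
  obtain ⟨A₂, hA₂, hA₂le⟩ := exists_nonneg_forall_le A₁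
  obtain ⟨h₀, hh₀, hh₀le⟩ := exists_pos_forall_le hh₁
  obtain ⟨d, hd, hsep⟩ := hγ.exists_separation
  set B := A₂ * (1 + 2 / d) with hB
  have hB0 : 0 ≤ B := by positivity
  refine ⟨lipschitzExtensionConstant Plane * B, by positivity, h₀, hh₀,
    fun h hpos hh N τ hn => ?_⟩
  choose e helip hebd herange using fun k =>
    hdisp k h (hh.trans_le (hh₀le k)) (N k) (τ k) (hn k)
  have hA₂B : A₂ ≤ B := by
    rw [hB, mul_add, mul_one]
    exact le_add_of_nonneg_right (by positivity)
  have hlip : ∀ i k s t, ‖e i s - e k t‖ ≤ B * h * ‖γ i s - γ k t‖ := by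
    intro i k s t
    rcases eq_or_ne i k with rfl | hne
    · refine (helip i s t).trans ?_
      have := (hA₂le i).trans hA₂B
      gcongr
    · have h1 := (hebd i s).trans (mul_le_mul_of_nonneg_right (hA₂le i) hpos.le)
      have h2 := (hebd k t).trans (mul_le_mul_of_nonneg_right (hA₂le k) hpos.le)
      calc ‖e i s - e k t‖ ≤ ‖e i s‖ + ‖e k t‖ := norm_sub_le _ _
        _ ≤ A₂ * h + A₂ * h := add_le_add h1 h2
        _ = A₂ * (2 / d) * h * d := by field_simp; ring
        _ ≤ B * h * ‖γ i s - γ k t‖ := by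
            have h3 := hsep i k hne s t
            have h4 : A₂ * (2 / d) ≤ B := by
              rw [hB]; gcongr; linarith
            gcongr
  have hex : ∀ x : frontier Ω, ∃ k t, γ k t = x := fun x => by
    exact mem_iUnion.1 (hγ.frontier_eq.subset x.2)
  choose k t hkt using hex
  classical
  let w₀ : Plane → Plane := fun x => if hx : x ∈ frontier Ω then e (k ⟨x, hx⟩) (t ⟨x, hx⟩) else 0
  have hw₀lip : LipschitzOnWith (Real.toNNReal (B * h)) w₀ (frontier Ω) := by
    refine LipschitzOnWith.of_dist_le_mul fun x hx y hy => ?_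
    rw [Real.coe_toNNReal _ (by positivity), dist_eq_norm, dist_eq_norm]
    simp only [w₀, hx, hy, dif_pos]
    have := hlip (k ⟨x, hx⟩) (k ⟨y, hy⟩) (t ⟨x, hx⟩) (t ⟨y, hy⟩)
    rwa [hkt, hkt] at this
  have hw₀ : ∀ i s, w₀ (γ i s) = e i s := by
    intro i s
    have hx : γ i s ∈ frontier Ω := hγ.frontier_eq ▸ mem_iUnion.2 ⟨i, mem_range_self s⟩
    have h1 := hlip (k ⟨_, hx⟩) i (t ⟨_, hx⟩) s
    rw [hkt, sub_self, norm_zero, mul_zero] at h1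
    simp only [w₀, hx, dif_pos]
    exact sub_eq_zero.1 (norm_le_zero_iff.1 h1)
  obtain ⟨w, hw, hww₀⟩ := hw₀lip.extend_finite_dimension
  refine ⟨w, ?_, ?_⟩
  · rwa [mul_assoc, Real.toNNReal_mul NNReal.zero_le_coe, Real.toNNReal_coe]
  · have himg : ∀ i, (fun x => x + w x) '' range (γ i) = polyLine (γ i) (τ i) := fun i => by
      rw [← herange i, ← range_comp]
      congr 1
      ext1 s
      have hx : γ i s ∈ frontier Ω := hγ.frontier_eq ▸ mem_iUnion.2 ⟨i, mem_range_self s⟩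
      simp only [Function.comp_apply]
      rw [← hww₀ hx, hw₀]
    rw [hγ.frontier_eq, image_iUnion]
    exact iUnion_congr himg

/-- A Lipschitz perturbation of the identity with a small constant is a homeomorphism. -/
theorem exists_homeomorph_of_lipschitz {ε : ℝ≥0} (hε : ε ≤ 1 / 2) {w : Plane → Plane}
    (hw : LipschitzWith ε w) :
    ∃ H : Plane ≃ₜ Plane, (∀ x, H x = x + w x) ∧ NearId (2 * ε) H ∧ NearId (2 * ε) H.symm := by
  have happ : ApproximatesLinearOn (fun x => x + w x)
      ((ContinuousLinearEquiv.refl ℝ Plane : Plane ≃L[ℝ] Plane) : Plane →L[ℝ] Plane) univ ε := by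
    intro x _ y _
    have := hw.dist_le_mul x y
    rw [dist_eq_norm, dist_eq_norm] at this
    refine le_trans (le_of_eq ?_) this
    congr 1
    simp only [ContinuousLinearEquiv.coe_refl, ContinuousLinearMap.coe_id', id_eq]
    abel
  have hlt : ε < 1 := hε.trans_lt (by rw [← NNReal.coe_lt_coe]; norm_num)
  let H : Plane ≃ₜ Plane := happ.toHomeomorph _ (Or.inr (by
    have : ‖((ContinuousLinearEquiv.refl ℝ Plane).symm : Plane →L[ℝ] Plane)‖₊ = 1 := by
      simp
    rw [this, inv_one]
    exact hlt))
  have hH : ∀ x, H x = x + w x := fun x => rfl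
  refine ⟨H, hH, ?_, ?_⟩
  · have : (fun x => H x - x) = w := by ext1 x; rw [hH, add_sub_cancel_left]
    rw [NearId, this]
    exact hw.weaken (by rw [two_mul]; exact le_add_self)
  · refine LipschitzWith.of_dist_le_mul fun y z => ?_
    obtain ⟨x, rfl⟩ := H.surjective y
    obtain ⟨x', rfl⟩ := H.surjective z
    rw [H.symm_apply_apply, H.symm_apply_apply, hH, hH, dist_eq_norm, dist_eq_norm]
    have h1 := hw.dist_le_mul x x'
    rw [dist_eq_norm, dist_eq_norm] at h1
    have hε' : (ε : ℝ) ≤ 1 / 2 := by exact_mod_cast hε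
    have h2 : ‖x - x'‖ ≤ ‖x + w x - (x' + w x')‖ + ‖w x - w x'‖ := by
      have := norm_sub_le (x + w x - (x' + w x')) (w x - w x')
      rwa [show x + w x - (x' + w x') - (w x - w x') = x - x' by abel] at this
    have h3 : (ε : ℝ) * ‖x - x'‖ ≤ 1 / 2 * ‖x - x'‖ := by gcongr
    have h4 : ‖x - x'‖ ≤ 2 * ‖x + w x - (x' + w x')‖ := by linarith
    rw [show x - (x + w x) - (x' - (x' + w x')) = -(w x - w x') by abel, norm_neg]
    calc ‖w x - w x'‖ ≤ ε * ‖x - x'‖ := h1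
      _ ≤ ε * (2 * ‖x + w x - (x' + w x')‖) := by gcongr
      _ = _ := by push_cast; ring

theorem exists_nearIdEquiv {Ω : Set Plane} {C : Finset Plane} (hΩ : IsCurvedLipschitzPolygon Ω C) :
    ∃ A ≥ 0, ∃ h₀ > 0, ∀ h, 0 < h → h < h₀ → ∀ P, IsPolygonalApproximation Ω C h P →
      ∃ H, NearIdEquiv (Real.toNNReal (A * h)) H Ω P := by
  obtain ⟨m, γ, hγ⟩ := hΩ.boundary
  obtain ⟨A, hA, h₀, hh₀, hdisp⟩ := hγ.exists_displacement
  refine ⟨2 * A, by positivity, min h₀ (1 / (32 * (A + 1))), lt_min hh₀ (by positivity),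
    fun h hpos hh P hP => ?_⟩
  obtain ⟨hPo, hPc, hPb, N, τ, hn, hPf⟩ := hP.exists_isNodeSeq hγ
  obtain ⟨w, hw, himg⟩ := hdisp h hpos (hh.trans_le (min_le_left _ _)) N τ hn
  have hAh : A * h ≤ 1 / 32 := by
    have h1 : h * (32 * (A + 1)) < 1 := by
      rw [← lt_div_iff₀ (by positivity)]
      exact hh.trans_le (min_le_right _ _)
    nlinarith
  have hε : Real.toNNReal (A * h) ≤ 1 / 32 := by
    rw [Real.toNNReal_le_iff_le_coe]
    simpa using hAh
  obtain ⟨H, hH, hH1, hH2⟩ := exists_homeomorph_of_lipschitz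
    (hε.trans (by rw [← NNReal.coe_le_coe]; norm_num)) hw
  have e2 : Real.toNNReal (2 * A * h) = 2 * Real.toNNReal (A * h) := by
    rw [mul_assoc, Real.toNNReal_mul (by norm_num), Real.toNNReal_ofNat]
  have hHf : H '' frontier Ω = frontier P := by
    rw [hPf, ← himg]
    exact image_congr fun x _ => hH x
  have hpre : frontier (H ⁻¹' P) = frontier Ω := by
    rw [← H.preimage_frontier, ← hHf, preimage_image_eq _ H.injective]
  have heq : H ⁻¹' P = Ω := by
    refine eq_of_frontier_eq (C := C) hΩ.isOpen (hPo.preimage H.continuous) hΩ.isConnected ?_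
      hΩ.isBounded ?_ hpre hγ.corners_subset fun x hx hxC => hγ.twoSidedAt hx hxC
    · rw [← H.image_symm]
      exact hPc.image _ H.symm.continuous.continuousOn
    · rw [← H.image_symm]
      exact hH2.lipschitz.isBounded_image hPb
  refine ⟨H, ?_, e2 ▸ hH1, e2 ▸ hH2, hPo, hPb.measure_lt_top.ne, heq.symm⟩
  rw [e2]
  calc 2 * Real.toNNReal (A * h) ≤ 2 * (1 / 32) := by gcongr
    _ = 1 / 16 := by rw [← NNReal.coe_inj]; norm_num

end LBB

theorem theoremT (Ω : Set (EuclideanSpace ℝ (Fin 2))) (C : Finset (EuclideanSpace ℝ (Fin 2)))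
    (hΩ : LBB.IsCurvedLipschitzPolygon Ω C) :
    ∃ c : ℝ, ∀ h : ℝ, 0 < h → ∀ Ωh : Set (EuclideanSpace ℝ (Fin 2)),
      LBB.IsPolygonalApproximation Ω C h Ωh → |LBB.beta Ω - LBB.beta Ωh| ≤ c * h := by
  obtain ⟨A, hA, h₀, hh₀, hex⟩ := LBB.exists_nearIdEquiv hΩ
  refine ⟨21 * A + 2 / h₀, fun h hpos P hP => ?_⟩
  rcases lt_or_ge h h₀ with hlt | hge
  · obtain ⟨H, hH⟩ := hex h hpos hlt P hP
    have h1 := hH.abs_beta_sub_le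
    rw [Real.coe_toNNReal _ (by positivity)] at h1
    have h2 : 0 ≤ 2 / h₀ * h := by positivity
    linarith
  · have h1 : 2 ≤ 2 / h₀ * h := by
      rw [div_mul_eq_mul_div, le_div_iff₀ hh₀]
      linarith
    have h2 : 0 ≤ 21 * A * h := by positivity
    have h3 : |LBB.beta Ω - LBB.beta P| ≤ 2 := by
      rw [abs_le]
      constructor <;> linarith [LBB.beta_nonneg Ω, LBB.beta_nonneg P, LBB.beta_le_two Ω,
        LBB.beta_le_two P]
    linarith
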